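/- Let $A=\begin{pmatrix}1&0\\0&0\end{pmatrix}$, $D=\begin{pmatrix}1&-1\\-1&1\end{pmatrix}$ and consider, for $U=(u,v)^T$, the one-dimensional boundary-damped system $$U''-U_{xx}+AU=0\ \text{ in }(0,\infty)\times(0,1),\qquad U(t,0)=0,\qquad U_x(t,1)+DU'(t,1)=0 .$$ Let $H_0=L^2(0,1)$ and $H_1=\{f\in H^1(0,1): f(0)=0\}$ (complex-valued functions, usual norms). Let $\mathcal A(U,V)=(V,-W)$ be the operator on $H_1^2\times H_0^2$ whose domain $D(\mathcal A)$ consists of all $(U,V)\in H_1^2\times H_1^2$ for which there is $W\in H_0^2$ with $$\int_0^1\big(\langle U_x,\Phi_x\rangle+\langle AU,\Phi\rangle\big)dx+\langle DV(1),\Phi(1)\rangle=\int_0^1\langle W,\Phi\rangle dx\quad\text{for all }\Phi\in H_1^2,$$ so that the system reads $(U,U')'=\mathcal A(U,U')$. Write $\|z\|_{D(\mathcal A)}=\|z\|+\|\mathcal Az\|$ for the graph norm. Then: 1. $A$ and $D$ are positive semidefinite, $\det D=0$, $\operatorname{rank}(D,AD)=2$ and $\|AD-DA\|=1$ (operator norm).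 2. Let $\beta,\beta_1\in\mathbb C$ be nonzero with $\beta_1^2=\beta^2+1$. Then $\beta$ is an eigenvalue of $\mathcal A$ if and only if $$\frac{\beta_1}{\beta}\cosh\beta_1\,(\sinh\beta+\cosh\beta)+\cosh\beta\,\sinh\beta_1=0 .$$ 3. There is a sequence $(\beta_n)$ of eigenvalues of $\mathcal A$ such that, with $\omega_n=(n+\tfrac12)\pi$, $$\beta_n=i\omega_n+\frac{i}{4\omega_n}-\frac1{32\,\omega_n^2}+O(n^{-3})\quad(n\to\infty);\qquad\text{in particular}\quad \operatorname{Re}\beta_n\sim-\frac1{32n^2\pi^2}.$$ 4. There is another sequence $(\gamma_n)$ of eigenvalues of $\mathcal A$ whose real parts stay away from $0$: $\gamma_n-in\pi\to-\tfrac12\ln 3$. 5. The decay rate $t^{-1/2}$ holds and is optimal. There is $M>0$ such that $\|Z(t)\|\le M t^{-1/2}\|Z(0)\|_{D(\mathcal A)}$ for all $t\ge1$ and all classical solutions $Z=(U,U')$ of the system (that is, $Z\in C^1([0,\infty);H_1^2\times H_0^2)$ with $Z(t)\in D(\mathcal A)$ and $Z'(t)=\mathcal AZ(t)$ for all $t\ge0$);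 and there is $c>0$ such that for every $t\ge1$ there is a classical solution $Z$ with $Z(0)\ne0$ and $\|Z(t)\|\ge c\,t^{-1/2}\|Z(0)\|_{D(\mathcal A)}$. -/

import Mathlib

open MeasureTheory Set Filter Topology Asymptotics
open scoped ContDiff InnerProductSpace ComplexOrder

noncomputable section

namespace BdryWave

/-- Lebesgue measure on the interval `(0,1)`. -/
abbrev unitMeasure : Measure ℝ := volume.restrict (Ioo (0 : ℝ) 1)

/-- The complex Lebesgue space `H₀ = L²(0,1)`. -/
abbrev L2 : Type := Lp ℂ 2 unitMeasure

/-- The primitive `x ↦ ∫₀ˣ g` of `g ∈ L²(0,1)`, for `x ∈ [0,1]`. -/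
def prim (g : L2) (x : ℝ) : ℂ := ∫ s in (0 : ℝ)..x, g s

theorem intervalIntegrable_L2 (g : L2) {x : ℝ} (hx : x ∈ Icc (0 : ℝ) 1) :
    IntervalIntegrable g volume 0 x := by
  have h1 : Integrable g unitMeasure := (Lp.memLp g).integrable (by norm_num)
  have h2 : IntegrableOn g (Ioc (0 : ℝ) 1) volume := by
    rw [integrableOn_Ioc_iff_integrableOn_Ioo]; exact h1
  rw [intervalIntegrable_iff_integrableOn_Ioc_of_le hx.1]
  exact h2.mono_set (Ioc_subset_Ioc_right hx.2)

theorem prim_congr {g : L2} {h : ℝ → ℂ} (hgh : g =ᵐ[unitMeasure] h) {x : ℝ}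
    (hx : x ∈ Icc (0 : ℝ) 1) : prim g x = ∫ s in (0 : ℝ)..x, h s := by
  have h1 : ∀ᵐ s ∂(volume : Measure ℝ), s ∈ Ioo (0 : ℝ) 1 → g s = h s :=
    (ae_restrict_iff' measurableSet_Ioo).1 hgh
  have h2 : ∀ᵐ s ∂(volume : Measure ℝ), s ≠ 1 := by
    simp [ae_iff, measure_singleton]
  refine intervalIntegral.integral_congr_ae ?_
  filter_upwards [h1, h2] with s hs hs1 hmem
  rw [uIoc_of_le hx.1] at hmem
  exact hs ⟨hmem.1, lt_of_le_of_ne (hmem.2.trans hx.2) hs1⟩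

theorem prim_add (f g : L2) {x : ℝ} (hx : x ∈ Icc (0 : ℝ) 1) :
    prim (f + g) x = prim f x + prim g x := by
  rw [prim_congr (Lp.coeFn_add f g) hx]
  exact intervalIntegral.integral_add (intervalIntegrable_L2 f hx) (intervalIntegrable_L2 g hx)

theorem prim_smul (c : ℂ) (g : L2) {x : ℝ} (hx : x ∈ Icc (0 : ℝ) 1) :
    prim (c • g) x = c * prim g x := by
  rw [prim_congr (Lp.coeFn_smul c g) hx]
  simp [prim]

theorem ae_mem_Icc : ∀ᵐ x ∂unitMeasure, x ∈ Icc (0 : ℝ) 1 :=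
  (ae_restrict_mem measurableSet_Ioo).mono fun _ hx => Ioo_subset_Icc_self hx

/-- The Sobolev space `H₁ = {f ∈ H¹(0,1) : f(0) = 0}`, as the space of pairs `(f, f')` of
elements of `L²(0,1)` such that `f(x) = ∫₀ˣ f'` for almost every `x`. Its norm is the `H¹` norm
`(‖f‖² + ‖f'‖²)^{1/2}`. -/
def H1 : Submodule ℂ (WithLp 2 (L2 × L2)) where
  carrier := {p | ∀ᵐ x ∂unitMeasure, p.fst x = prim p.snd x}
  zero_mem' := by
    have h0 : ((0 : L2) : ℝ → ℂ) =ᵐ[unitMeasure] 0 := Lp.coeFn_zero ℂ 2 unitMeasure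
    filter_upwards [h0, ae_mem_Icc] with x hx hxI
    have := prim_congr h0 hxI
    simp only [WithLp.zero_fst, WithLp.zero_snd]
    rw [hx, this]; simp
  add_mem' := by
    intro p q hp hq
    filter_upwards [hp, hq, ae_mem_Icc, Lp.coeFn_add p.fst q.fst] with x h1 h2 hxI h3
    simp only [WithLp.add_fst, WithLp.add_snd]
    rw [h3, prim_add _ _ hxI, Pi.add_apply, h1, h2]
  smul_mem' := by
    intro c p hp
    filter_upwards [hp, ae_mem_Icc, Lp.coeFn_smul c p.fst] with x h1 hxI h3
    simp only [WithLp.smul_fst, WithLp.smul_snd]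
    rw [h3, prim_smul _ _ hxI, Pi.smul_apply, h1, smul_eq_mul]

theorem one_mem : (1 : ℝ) ∈ Icc (0 : ℝ) 1 := ⟨zero_le_one, le_rfl⟩

/-- The function `f ∈ L²(0,1)` underlying an element of `H₁`. -/
def toL2 : H1 →ₗ[ℂ] L2 where
  toFun f := f.1.fst
  map_add' _ _ := rfl
  map_smul' _ _ := rfl

/-- The weak derivative `f' ∈ L²(0,1)` of an element of `H₁`. -/
def der : H1 →ₗ[ℂ] L2 where
  toFun f := f.1.snd
  map_add' _ _ := rfl
  map_smul' _ _ := rfl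

/-- The boundary value `f(1) = ∫₀¹ f'` of an element of `H₁`. -/
def trace : H1 →ₗ[ℂ] ℂ where
  toFun f := prim (der f) 1
  map_add' f g := by rw [map_add, prim_add _ _ one_mem]
  map_smul' c f := by rw [map_smul, prim_smul _ _ one_mem]; rfl

theorem H1_ext_of_toL2 {f : H1} (h : toL2 f = 0) : f = 0 := by
  have h1 : (fun x => prim (der f) x) =ᵐ[unitMeasure] fun _ => (0 : ℂ) := by
    have h2 : ((toL2 f : L2) : ℝ → ℂ) =ᵐ[unitMeasure] 0 := by
      rw [h]; exact Lp.coeFn_zero ℂ 2 unitMeasure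
    filter_upwards [f.2, h2] with x hx hx2
    exact hx.symm.trans hx2
  have hint := intervalIntegrable_L2 (der f) one_mem
  have hc : ContinuousOn (fun x => prim (der f) x) (Ioo 0 1) := by
    have := intervalIntegral.continuousOn_primitive_interval' hint left_mem_uIcc
    rw [uIcc_of_le zero_le_one] at this
    exact this.mono Ioo_subset_Icc_self
  have h3 : EqOn (fun x => prim (der f) x) (fun _ => (0 : ℂ)) (Ioo 0 1) :=
    Measure.eqOn_Ioo_of_ae_eq (μ := volume) h1 hc continuousOn_const
  have h4 : der f = 0 := by
    rw [Lp.eq_zero_iff_ae_eq_zero]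
    have h5 := ae_restrict_of_ae (s := Ioo (0 : ℝ) 1) hint.ae_hasDerivAt_integral
    filter_upwards [h5, ae_restrict_mem measurableSet_Ioo] with x hx hxI
    have h6 := hx (by rw [uIcc_of_le zero_le_one]; exact Ioo_subset_Icc_self hxI) 0
      (by simp)
    have h7 : HasDerivAt (fun _ : ℝ => (0 : ℂ)) (der f x) x :=
      h6.congr_of_eventuallyEq
        ((h3.eventuallyEq_of_mem (isOpen_Ioo.mem_nhds hxI)).symm)
    exact h7.unique (hasDerivAt_const x (0 : ℂ))
  apply Subtype.ext
  exact WithLp.ofLp_injective 2 (Prod.ext h h4)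

variable {N : ℕ}

/-- The state space `(H₁)ᴺ × (H₀)ᴺ` of pairs `(U, V)`, with its product Hilbert norm. -/
abbrev State (N : ℕ) : Type :=
  WithLp 2 (PiLp 2 (fun _ : Fin N => H1) × PiLp 2 (fun _ : Fin N => L2))

instance : NormedAddCommGroup (PiLp 2 (fun _ : Fin N => H1)) := inferInstance
instance : InnerProductSpace ℂ (PiLp 2 (fun _ : Fin N => H1)) := inferInstance
instance : NormedAddCommGroup (PiLp 2 (fun _ : Fin N => L2)) := inferInstance
instance : InnerProductSpace ℂ (PiLp 2 (fun _ : Fin N => L2)) := inferInstance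
instance : NormedAddCommGroup (State N) := inferInstance
instance : InnerProductSpace ℂ (State N) := inferInstance
instance : NormedSpace ℂ (State N) := InnerProductSpace.toNormedSpace

/-- The functional `LU + AU + D G*G V` on `(H₁)ᴺ`, evaluated at the conjugate of `Φ`:
`∫₀¹ (⟨U_x, Φ_x⟩ + ⟨A U, Φ⟩) dx + ⟨D V(1), Φ(1)⟩`. -/
def form (A D : Matrix (Fin N) (Fin N) ℂ) (U V Φ : Fin N → H1) : ℂ :=
  ∑ i, (⟪der (Φ i), der (U i)⟫_ℂ + ∑ j, A i j * ⟪toL2 (Φ i), toL2 (U j)⟫_ℂ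
    + ∑ j, D i j * (trace (V j) * (starRingEnd ℂ) (trace (Φ i))))

/-- The graph of `𝒜(U, V) = (V, -LU - AU - D G*G V)` on the domain of all `(U, V) ∈ (H₁)ᴺ × (H₁)ᴺ`
for which `LU + AU + D G*G V` belongs to `(L²(0,1))ᴺ`. A pair `(Z, Y)` belongs to it when
`Z = (U, V)`, `Y = (V, -W)`, with `V ∈ (H₁)ᴺ` and `LU + AU + D G*G V = W ∈ (L²(0,1))ᴺ` as
functionals on `(H₁)ᴺ`. -/
def genGraph (A D : Matrix (Fin N) (Fin N) ℂ) : Submodule ℂ (State N × State N) where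
  carrier := {p | (∀ i, p.1.snd i = toL2 (p.2.fst i)) ∧
    ∀ Φ : Fin N → H1, form A D p.1.fst p.2.fst Φ = -∑ i, ⟪toL2 (Φ i), p.2.snd i⟫_ℂ}
  zero_mem' := by
    refine ⟨fun i => rfl, fun Φ => ?_⟩
    simp [form]
  add_mem' := by
    rintro p q ⟨hp1, hp2⟩ ⟨hq1, hq2⟩
    refine ⟨fun i => ?_, fun Φ => ?_⟩
    · simp [hp1 i, hq1 i]
    · have e : form A D (p + q).1.fst (p + q).2.fst Φ
          = form A D p.1.fst p.2.fst Φ + form A D q.1.fst q.2.fst Φ := by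
        simp only [form, ← Finset.sum_add_distrib]
        refine Finset.sum_congr rfl fun i _ => ?_
        simp only [Prod.fst_add, Prod.snd_add, WithLp.add_fst, PiLp.add_apply, map_add,
          inner_add_right, mul_add, add_mul, Finset.sum_add_distrib]
        ring
      rw [e, hp2, hq2]
      simp only [Prod.snd_add, WithLp.add_snd, PiLp.add_apply, inner_add_right,
        Finset.sum_add_distrib]
      ring
  smul_mem' := by
    rintro c p ⟨hp1, hp2⟩
    refine ⟨fun i => ?_, fun Φ => ?_⟩
    · simp [hp1 i]
    · have e : form A D (c • p).1.fst (c • p).2.fst Φ = c * form A D p.1.fst p.2.fst Φ := by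
        simp only [form, Finset.mul_sum]
        refine Finset.sum_congr rfl fun i _ => ?_
        simp only [Prod.smul_fst, Prod.smul_snd, WithLp.smul_fst, PiLp.smul_apply, map_smul, smul_eq_mul,
          inner_smul_right, mul_add, Finset.mul_sum]
        congr 1
        · congr 1
          exact Finset.sum_congr rfl fun j _ => by ring
        · exact Finset.sum_congr rfl fun j _ => by ring
      rw [e, hp2]
      simp only [Prod.smul_snd, WithLp.smul_snd, PiLp.smul_apply, inner_smul_right,
        Finset.mul_sum, mul_neg]

theorem exists_H1_of_contDiff {φ : ℝ → ℝ} (hφ : ContDiff ℝ ∞ φ) (h0 : φ 0 = 0) :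
    ∃ f : H1, toL2 f =ᵐ[unitMeasure] fun x => (φ x : ℂ) := by
  have hc : Continuous fun x => (φ x : ℂ) := Complex.continuous_ofReal.comp hφ.continuous
  have hd : Continuous fun x => ((deriv φ x : ℝ) : ℂ) :=
    Complex.continuous_ofReal.comp (hφ.continuous_deriv (by simp))
  have key : ∀ g : ℝ → ℂ, Continuous g → MemLp g 2 unitMeasure := by
    intro g hg
    obtain ⟨C, hC⟩ := isCompact_Icc.exists_bound_of_continuousOn (s := Icc (0 : ℝ) 1)
      hg.continuousOn
    refine MemLp.of_bound hg.aestronglyMeasurable C ?_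
    filter_upwards [ae_mem_Icc] with x hx using hC x hx
  have m1 := key _ hc
  have m2 := key _ hd
  refine ⟨⟨WithLp.toLp 2 (m1.toLp, m2.toLp), ?_⟩, m1.coeFn_toLp⟩
  change ∀ᵐ x ∂unitMeasure, (m1.toLp : ℝ → ℂ) x = prim m2.toLp x
  filter_upwards [m1.coeFn_toLp, ae_mem_Icc] with x hx hxI
  rw [hx, prim_congr m2.coeFn_toLp hxI, intervalIntegral.integral_ofReal,
    intervalIntegral.integral_deriv_eq_sub
      (fun y _ => (hφ.differentiable (by simp)).differentiableAt)
      ((hφ.continuous_deriv (by simp)).intervalIntegrable _ _), h0, sub_zero]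

theorem eq_zero_of_inner_H1 (w : L2) (h : ∀ f : H1, ⟪toL2 f, w⟫_ℂ = 0) : w = 0 := by
  have hw : Integrable w unitMeasure := (Lp.memLp w).integrable (by norm_num)
  have h1 : ∀ᵐ x ∂unitMeasure, x ∈ Ioo (0 : ℝ) 1 → w x = 0 := by
    refine isOpen_Ioo.ae_eq_zero_of_integral_contDiff_smul_eq_zero
      (hw.locallyIntegrable.locallyIntegrableOn _) ?_
    intro φ hφ _ hs
    have h0 : φ 0 = 0 := by
      by_contra hne
      exact absurd (hs (subset_tsupport _ hne)) (by simp)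
    obtain ⟨f, hf⟩ := exists_H1_of_contDiff hφ h0
    rw [← h f, L2.inner_def]
    refine integral_congr_ae ?_
    filter_upwards [hf] with x hx
    rw [hx]
    simp [mul_comm]
  refine (Lp.eq_zero_iff_ae_eq_zero).2 ?_
  filter_upwards [h1, ae_restrict_mem measurableSet_Ioo] with x hx hxI using hx hxI

/-- `genGraph` is single valued, so it is the graph of a linear operator. -/
theorem genGraph_single (A D : Matrix (Fin N) (Fin N) ℂ) (p : State N × State N)
    (hp : p ∈ genGraph A D) (h0 : p.1 = 0) : p.2 = 0 := by
  obtain ⟨h1, h2⟩ := hp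
  have hU : p.1.fst = 0 := by rw [h0]; rfl
  have hV : p.2.fst = 0 := by
    ext1 i
    refine H1_ext_of_toL2 ?_
    rw [← h1 i, h0]; rfl
  have hW : p.2.snd = 0 := by
    ext1 i
    refine eq_zero_of_inner_H1 _ fun f => ?_
    have h3 := h2 (Pi.single i f)
    rw [hU, hV, Finset.sum_eq_single i] at h3
    · simpa [form] using h3
    · intro j _ hj
      rw [Pi.single_eq_of_ne hj]; simp
    · simp
  exact WithLp.ofLp_injective 2 (Prod.ext hV hW)

/-- The generator `𝒜(U, V) = (V, -LU - AU - D G*G V)`, with domain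
`{(U, V) ∈ (H₁)ᴺ × (H₁)ᴺ : LU + AU + D G*G V ∈ (H₀)ᴺ}`, as an unbounded operator on the state
space; this is the operator of `U'' - U_xx + AU = 0`, `U(0) = 0`, `U_x(1) + D U'(1) = 0`. -/
def gen (A D : Matrix (Fin N) (Fin N) ℂ) : State N →ₗ.[ℂ] State N :=
  (genGraph A D).toLinearPMap

theorem gen_graph (A D : Matrix (Fin N) (Fin N) ℂ) : (gen A D).graph = genGraph A D :=
  Submodule.toLinearPMap_graph_eq _ (genGraph_single A D)

/-- `μ` is an eigenvalue of the unbounded operator `T`. -/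
def IsEigenvalue {E : Type*} [AddCommGroup E] [Module ℂ E] (T : E →ₗ.[ℂ] E) (μ : ℂ) : Prop :=
  ∃ z : T.domain, (z : E) ≠ 0 ∧ T z = μ • (z : E)

/-- `Z : [0,∞) → E` is a classical solution of `Z' = T Z` with initial datum `z` in the domain of
`T`: it is continuously differentiable, takes its values in the domain, and satisfies the equation
for all `t ≥ 0`. -/
def IsClassicalSolution {E : Type*} [NormedAddCommGroup E] [NormedSpace ℂ E]
    (T : E →ₗ.[ℂ] E) (z : T.domain) (Z : ℝ → E) : Prop :=
  Z 0 = z ∧ ContDiffOn ℝ 1 Z (Ici 0) ∧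
    ∀ t : ℝ, 0 ≤ t → ∃ h : Z t ∈ T.domain, HasDerivWithinAt Z (T ⟨Z t, h⟩) (Ici 0) t

/-- The graph norm `‖z‖ + ‖T z‖` on the domain of `T`. -/
def graphNorm {E : Type*} [NormedAddCommGroup E] [NormedSpace ℂ E]
    (T : E →ₗ.[ℂ] E) (z : T.domain) : ℝ := ‖(z : E)‖ + ‖T z‖

/-- The coupling matrix of the example. -/
def matA : Matrix (Fin 2) (Fin 2) ℂ := !![1, 0; 0, 0]

/-- The damping matrix of the example. -/
def matD : Matrix (Fin 2) (Fin 2) ℂ := !![1, -1; -1, 1]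

/-- The generator of the system of the example. -/
def exGen : State 2 →ₗ.[ℂ] State 2 := gen matA matD

end BdryWave

end

/-!
Throughout, `u` and `v` are the two displacements, `w = u - v`, and `d = u'(1) - v'(1)` is the only
quantity that is damped: the energy decreases at the rate `2 |d|²`.

*Eigenvalues.* Elements of the graph of the generator satisfy the differential equations and
boundary conditions almost everywhere (`ae_eq_of_weak`), so an eigenvector for `b` consists of
multiples of `sinh (b₁ x)` and `sinh (b x)` (`prim_der_eq_sinh`). The boundary conditions at `1` are
a `2 × 2` linear system for the two multiples, whose determinant gives the characteristic equation
(`isEigenvalue_exGen_iff`).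

*Asymptotics.* With `σ = 1/β`, both `β₁/β = √(1 + σ²)` and `β₁ - β` are analytic at `σ = 0`. Near
`y₀ + n π i` the characteristic equation is therefore an analytic perturbation, with small parameter
`1/(y₀ + n π i)`, of the equation `cosh y (e^y + sinh y) = 0`, whose zeros modulo `π i` are
`y₀ = iπ/2` and `y₀ = -(ln 3)/2`; both are simple. Simple zeros persist, at a distance from an
approximate zero that is bounded by the value of the function there (`exists_zero_of_simple_zero`,
`exists_eigenvalues_near`). For `y₀ = iπ/2`, the approximate zero `-τ/4 + τ²/32` satisfies the
equation up to `O(τ³)` (`charFun_approxZero_isBigO`), which gives the expansion of `β_n`.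

*Decay.* The difference solves `w'' - w_xx = -u` with `w_x(1) = -2 d` and `w'(1) = d`, so the
multipliers `x w_x` and `w` apply to it; pairing the equation of `w` with `u` and that of `u` with
`w` brings in `-‖u‖²`. Together they produce the form `2‖w_x‖² + ‖u‖² + 2 Re ∫ x w̄_x u`, which is
positive definite. What is missing is `u'`, which then controls `u_x`. It is estimated by the
pairing of `u` with `w`, applied to the time derivative of the solution, at the cost of one
derivative of the initial datum: this is where exponential decay is lost. The derivative is only a
limit of solutions, namely of difference quotients (`exists_integral_defect_deriv_le`). The outcome is
`∫₀ᵀ E ≤ C ‖Z(0)‖²_{D(𝒜)}` for the energy `E`; as `E` is nonincreasing, `T E(T)` is bounded by the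
same quantity (`energy_le_lyapDer`, `exists_mul_energy_le`, `exists_decay_rate`).

*Optimality.* For the eigenvectors `z` with eigenvalue `β_n`, the solution `e^{β_n t} z` has decayed
only by a constant factor at times `t ≈ n²`, as `Re β_n ≈ -1/(32 n² π²)`, while the graph norm of `z`
is of order `n ‖z‖ ≈ √t ‖z‖` (`exists_slow_solutions`).
-/

noncomputable section

namespace BdryWave

/-! ### Primitives, integration by parts and the space `H₁` -/

/-- Domination by the primitive of `‖f‖` reduces this to the real-valued case. -/
theorem absolutelyContinuousOnInterval_primitive {f : ℝ → ℂ} {a b : ℝ}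
    (hf : IntervalIntegrable f volume a b) :
    AbsolutelyContinuousOnInterval (fun x => ∫ s in a..x, f s) a b := by
  have hn := hf.norm.absolutelyContinuousOnInterval_intervalIntegral (c := a) left_mem_uIcc
  refine squeeze_zero' ?_ ?_ hn
  · filter_upwards with p
    exact Finset.sum_nonneg fun _ _ => dist_nonneg
  · have : ∀ᶠ E : ℕ × (ℕ → ℝ × ℝ) in AbsolutelyContinuousOnInterval.totalLengthFilter ⊓
        𝓟 (AbsolutelyContinuousOnInterval.disjWithin a b),
        E ∈ AbsolutelyContinuousOnInterval.disjWithin a b :=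
      eventually_inf_principal.mpr (by simp)
    filter_upwards [this] with p hp
    refine Finset.sum_le_sum fun i hi => ?_
    have h1 : (p.2 i).1 ∈ uIcc a b := (hp.1 i hi).1
    have h2 : (p.2 i).2 ∈ uIcc a b := (hp.1 i hi).2
    have i1 : IntervalIntegrable f volume a (p.2 i).1 :=
      hf.mono_set (uIcc_subset_uIcc left_mem_uIcc h1)
    have i2 : IntervalIntegrable f volume a (p.2 i).2 :=
      hf.mono_set (uIcc_subset_uIcc left_mem_uIcc h2)
    rw [dist_comm, dist_comm (∫ s in a..(p.2 i).1, ‖f s‖), dist_eq_norm, Real.dist_eq,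
      intervalIntegral.integral_interval_sub_left i2 i1,
      intervalIntegral.integral_interval_sub_left i2.norm i1.norm]
    exact intervalIntegral.norm_integral_le_abs_integral_norm

/-- The fundamental theorem of calculus for complex-valued absolutely continuous functions. -/
theorem integral_eq_sub_of_absolutelyContinuous {F f : ℝ → ℂ} {a b : ℝ}
    (hF : AbsolutelyContinuousOnInterval F a b) (hf : IntervalIntegrable f volume a b)
    (hd : ∀ᵐ x, x ∈ uIcc a b → HasDerivAt F (f x) x) :
    ∫ x in a..b, f x = F b - F a := by
  obtain ⟨C, hC⟩ := (hF.sub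
    (absolutelyContinuousOnInterval_primitive hf)).const_of_ae_hasDerivAt_zero (by
      filter_upwards [hd, hf.ae_hasDerivAt_integral] with x h1 h2 hx
      simpa using (h1 hx).sub (h2 hx a left_mem_uIcc))
  have h1 := hC a left_mem_uIcc
  have h2 := hC b right_mem_uIcc
  simp only [Pi.sub_apply, intervalIntegral.integral_same, sub_zero] at h1 h2
  rw [h1, ← h2]; ring

theorem absolutelyContinuousOnInterval_const_add_prim (c : ℂ) (g : L2) :
    AbsolutelyContinuousOnInterval (fun x => c + prim g x) 0 1 := by
  have h : AbsolutelyContinuousOnInterval (fun _ : ℝ => c) 0 1 :=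
    (contDiff_const (n := 1)).contDiffOn.absolutelyContinuousOnInterval
  exact h.add (absolutelyContinuousOnInterval_primitive (intervalIntegrable_L2 g one_mem))

theorem absolutelyContinuousOnInterval_conj {F : ℝ → ℂ} {a b : ℝ}
    (hF : AbsolutelyContinuousOnInterval F a b) :
    AbsolutelyContinuousOnInterval (fun x => (starRingEnd ℂ) (F x)) a b := by
  have h : ∀ z w : ℂ, dist ((starRingEnd ℂ) z) ((starRingEnd ℂ) w) = dist z w :=
    fun z w => Complex.dist_conj_conj z w
  simpa only [AbsolutelyContinuousOnInterval, h] using hF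

theorem ae_hasDerivAt_const_add_prim (c : ℂ) (g : L2) :
    ∀ᵐ x : ℝ, x ∈ uIcc (0 : ℝ) 1 → HasDerivAt (fun x => c + prim g x) (g x) x := by
  filter_upwards [(intervalIntegrable_L2 g one_mem).ae_hasDerivAt_integral] with x hx hxI
  exact (hx hxI 0 left_mem_uIcc).const_add c

theorem hasDerivAt_conj {F : ℝ → ℂ} {f : ℂ} {x : ℝ} (h : HasDerivAt F f x) :
    HasDerivAt (fun x => (starRingEnd ℂ) (F x)) ((starRingEnd ℂ) f) x :=
  Complex.conjCLE.hasFDerivAt.comp_hasDerivAt x h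

theorem continuousOn_const_add_prim (c : ℂ) (g : L2) :
    ContinuousOn (fun x => c + prim g x) (Icc 0 1) := by
  have := (absolutelyContinuousOnInterval_const_add_prim c g).continuousOn
  rwa [uIcc_of_le zero_le_one] at this

theorem integral_unitMeasure (f : ℝ → ℂ) : ∫ x, f x ∂unitMeasure = ∫ x in (0 : ℝ)..1, f x := by
  rw [intervalIntegral.integral_of_le zero_le_one, integral_Ioc_eq_integral_Ioo]

theorem ae_of_ae_unitMeasure {p : ℝ → Prop} (h : ∀ᵐ x ∂unitMeasure, p x) :
    ∀ᵐ x : ℝ, x ∈ uIoc (0 : ℝ) 1 → p x := by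
  have h1 : ∀ᵐ s ∂(volume : Measure ℝ), s ∈ Ioo (0 : ℝ) 1 → p s :=
    (ae_restrict_iff' measurableSet_Ioo).1 h
  have h2 : ∀ᵐ s ∂(volume : Measure ℝ), s ≠ 1 := by
    simp [ae_iff, measure_singleton]
  filter_upwards [h1, h2] with s hs hs1 hmem
  rw [uIoc_of_le zero_le_one] at hmem
  exact hs ⟨hmem.1, lt_of_le_of_ne hmem.2 hs1⟩

instance : IsProbabilityMeasure unitMeasure := ⟨by simp⟩

theorem memLp_of_continuousOn {f : ℝ → ℂ} (hf : ContinuousOn f (Icc 0 1)) :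
    MemLp f 2 unitMeasure := by
  obtain ⟨C, hC⟩ := isCompact_Icc.exists_bound_of_continuousOn (s := Icc (0 : ℝ) 1) hf
  refine MemLp.of_bound
    ((hf.mono Ioo_subset_Icc_self).aestronglyMeasurable measurableSet_Ioo) C ?_
  filter_upwards [ae_mem_Icc] with x hx using hC x hx

theorem memLp_prim (g : L2) : MemLp (prim g) 2 unitMeasure :=
  memLp_of_continuousOn (by simpa using continuousOn_const_add_prim 0 g)

/-- The element of `H₁` with weak derivative `g`. -/
def ofDer (g : L2) : H1 := ⟨WithLp.toLp 2 ((memLp_prim g).toLp, g), (memLp_prim g).coeFn_toLp⟩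

@[simp] theorem der_ofDer (g : L2) : der (ofDer g) = g := rfl

theorem toL2_ae (f : H1) : toL2 f =ᵐ[unitMeasure] prim (der f) := f.2

theorem norm_prim_le (g : L2) {x : ℝ} (hx : x ∈ Icc (0 : ℝ) 1) : ‖prim g x‖ ≤ ‖g‖ := by
  have hg : MemLp g 2 unitMeasure := Lp.memLp g
  have h0 : ‖prim g x‖ ≤ ∫ s in (0 : ℝ)..x, ‖g s‖ :=
    intervalIntegral.norm_integral_le_integral_norm hx.1
  have h1 : ∫ s in (0 : ℝ)..x, ‖g s‖ ≤ ∫ s in (0 : ℝ)..1, ‖g s‖ :=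
    intervalIntegral.integral_mono_interval le_rfl hx.1 hx.2
      (Eventually.of_forall fun _ => norm_nonneg _) (intervalIntegrable_L2 g one_mem).norm
  have h2 : ∫ s in (0 : ℝ)..1, ‖g s‖ = ∫ s, ‖g s‖ ∂unitMeasure := by
    rw [intervalIntegral.integral_of_le zero_le_one, integral_Ioc_eq_integral_Ioo]
  have h3 : ∫ s, ‖g s‖ ∂unitMeasure = (eLpNorm g 1 unitMeasure).toReal := by
    rw [eLpNorm_one_eq_lintegral_enorm, integral_norm_eq_lintegral_enorm hg.1]
  have h4 : eLpNorm g 1 unitMeasure ≤ eLpNorm g 2 unitMeasure :=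
    eLpNorm_le_eLpNorm_of_exponent_le (by norm_num) hg.1
  rw [Lp.norm_def]
  have := ENNReal.toReal_mono hg.eLpNorm_ne_top h4
  linarith

theorem norm_trace_le (f : H1) : ‖trace f‖ ≤ ‖der f‖ := norm_prim_le _ one_mem

theorem norm_toL2_le_norm_der (f : H1) : ‖toL2 f‖ ≤ ‖der f‖ := by
  have := Lp.norm_le_of_ae_bound (f := toL2 f) (norm_nonneg (der f)) (by
    filter_upwards [toL2_ae f, ae_mem_Icc] with x hx hxI
    rw [hx]; exact norm_prim_le _ hxI)
  simpa [measureUnivNNReal] using this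

theorem H1_norm_sq (f : H1) : ‖f‖ ^ 2 = ‖toL2 f‖ ^ 2 + ‖der f‖ ^ 2 :=
  WithLp.prod_norm_sq_eq_of_L2 f.1

theorem norm_der_le (f : H1) : ‖der f‖ ≤ ‖f‖ := by
  have := H1_norm_sq f
  exact le_of_sq_le_sq (by nlinarith [sq_nonneg ‖toL2 f‖]) (norm_nonneg _)

theorem norm_toL2_le (f : H1) : ‖toL2 f‖ ≤ ‖f‖ := (norm_toL2_le_norm_der f).trans (norm_der_le f)

/-- Integration by parts of an element of `H₁` against a function `f` with `f' = h ∈ L²(0,1)`. -/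
theorem inner_der_add_inner_toL2 (φ : H1) {f h : L2} {c : ℂ}
    (hf : f =ᵐ[unitMeasure] fun x => c + prim h x) :
    ⟪der φ, f⟫_ℂ + ⟪toL2 φ, h⟫_ℂ = (c + prim h 1) * (starRingEnd ℂ) (trace φ) := by
  have a1 := absolutelyContinuousOnInterval_const_add_prim c h
  have a2 := absolutelyContinuousOnInterval_conj
    (absolutelyContinuousOnInterval_const_add_prim 0 (der φ))
  have hi1 := intervalIntegrable_L2 h one_mem
  have hi2 : IntervalIntegrable (fun x => (starRingEnd ℂ) (der φ x)) volume 0 1 := by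
    have := intervalIntegrable_L2 (der φ) one_mem
    exact ⟨Complex.conjCLE.integrable_comp_iff.2 this.1,
      Complex.conjCLE.integrable_comp_iff.2 this.2⟩
  have key := integral_eq_sub_of_absolutelyContinuous
    (f := fun x => (starRingEnd ℂ) (der φ x) * (c + prim h x)
      + (starRingEnd ℂ) (0 + prim (der φ) x) * h x) (a2.smul a1)
    ((hi2.mul_continuousOn a1.continuousOn).add (hi1.continuousOn_mul a2.continuousOn)) (by
      filter_upwards [ae_hasDerivAt_const_add_prim c h, ae_hasDerivAt_const_add_prim 0 (der φ)]
        with x h1 h2 hx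
      exact (hasDerivAt_conj (h2 hx)).mul (h1 hx))
  rw [L2.inner_def, L2.inner_def, ← integral_add (L2.integrable_inner _ _)
    (L2.integrable_inner _ _), integral_unitMeasure]
  have e : ∫ x in (0 : ℝ)..1, (⟪der φ x, f x⟫_ℂ + ⟪toL2 φ x, h x⟫_ℂ)
      = ∫ x in (0 : ℝ)..1, ((starRingEnd ℂ) (der φ x) * (c + prim h x)
      + (starRingEnd ℂ) (0 + prim (der φ) x) * h x) := by
    refine intervalIntegral.integral_congr_ae (ae_of_ae_unitMeasure ?_)
    filter_upwards [hf, toL2_ae φ] with x h1 h2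
    rw [h1, h2]; simp [RCLike.inner_apply]; ring
  rw [e, key]
  have h0 : prim (der φ) 0 = 0 := by simp [prim]
  simp only [Pi.smul_apply', smul_eq_mul, h0, zero_add, map_zero, zero_mul, sub_zero]
  rw [mul_comm]; rfl

/-- A function in `L²(0,1)` satisfying the weak form of `f' = h`, `f(1) = -κ`, is absolutely
continuous and satisfies these equations. -/
theorem ae_eq_of_weak {f h : L2} {κ : ℂ}
    (H : ∀ φ : H1, ⟪der φ, f⟫_ℂ + ⟪toL2 φ, h⟫_ℂ + κ * (starRingEnd ℂ) (trace φ) = 0) :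
    f =ᵐ[unitMeasure] fun x => (-κ - prim h 1) + prim h x := by
  have hc := memLp_of_continuousOn (continuousOn_const_add_prim (-κ - prim h 1) h)
  have hae := hc.coeFn_toLp
  set G : L2 := hc.toLp
  -- every element of `L²` is a derivative of some `φ`, so `f - G` is orthogonal to all of `L²`
  have h1 : ∀ φ : H1, ⟪der φ, f - G⟫_ℂ = 0 := by
    intro φ
    have e1 := H φ
    have e2 := inner_der_add_inner_toL2 φ hae
    rw [inner_sub_right]
    linear_combination e1 - e2
  have h2 := h1 (ofDer (f - G))
  rw [der_ofDer, inner_self_eq_zero, sub_eq_zero] at h2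
  rw [h2]; exact hae

theorem memLp_mul_coordinate (f : L2) :
    MemLp (fun x : ℝ => (x : ℂ) * f x) 2 unitMeasure :=
  (Lp.memLp f).of_le
    (Complex.continuous_ofReal.aestronglyMeasurable.mul (Lp.aestronglyMeasurable f)) (by
      filter_upwards [ae_mem_Icc] with x hx
      rw [norm_mul, Complex.norm_real, Real.norm_of_nonneg hx.1]
      exact mul_le_of_le_one_left (norm_nonneg _) hx.2)

theorem norm_toLp_mul_coordinate_le (f : L2) : ‖(memLp_mul_coordinate f).toLp‖ ≤ ‖f‖ := by
  refine Lp.norm_le_norm_of_ae_le ?_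
  filter_upwards [(memLp_mul_coordinate f).coeFn_toLp, ae_mem_Icc] with x h1 hx
  rw [h1, norm_mul, Complex.norm_real, Real.norm_of_nonneg hx.1]
  exact mul_le_of_le_one_left (norm_nonneg _) hx.2

/-- Multiplication by the coordinate `x` on `L²(0,1)`. -/
def mulX : L2 →L[ℂ] L2 :=
  LinearMap.mkContinuous
    { toFun := fun f => (memLp_mul_coordinate f).toLp
      map_add' := fun f g => by
        apply Lp.ext
        filter_upwards [(memLp_mul_coordinate (f + g)).coeFn_toLp,
          (memLp_mul_coordinate f).coeFn_toLp, (memLp_mul_coordinate g).coeFn_toLp,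
          Lp.coeFn_add f g,
          Lp.coeFn_add (memLp_mul_coordinate f).toLp (memLp_mul_coordinate g).toLp]
          with x h1 h2 h3 h4 h5
        rw [h1, h5, Pi.add_apply, h2, h3, h4, Pi.add_apply, mul_add]
      map_smul' := fun c f => by
        apply Lp.ext
        filter_upwards [(memLp_mul_coordinate (c • f)).coeFn_toLp,
          (memLp_mul_coordinate f).coeFn_toLp, Lp.coeFn_smul c f,
          Lp.coeFn_smul c (memLp_mul_coordinate f).toLp] with x h1 h2 h3 h4
        simp only [RingHom.id_apply]
        rw [h1, h4, Pi.smul_apply, h2, h3, Pi.smul_apply, smul_eq_mul, smul_eq_mul]; ring } 1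
    (fun f => (norm_toLp_mul_coordinate_le f).trans_eq (one_mul _).symm)

theorem mulX_ae (f : L2) : mulX f =ᵐ[unitMeasure] fun x : ℝ => (x : ℂ) * f x :=
  (memLp_mul_coordinate f).coeFn_toLp

theorem norm_mulX_le (f : L2) : ‖mulX f‖ ≤ ‖f‖ := norm_toLp_mul_coordinate_le f

/-- The identity behind the multiplier `x f`: `2 Re ∫₀¹ x f̄ f' = |f(1)|² - ∫₀¹ |f|²`. -/
theorem two_re_inner_mulX {f h : L2} {c : ℂ} (hf : f =ᵐ[unitMeasure] fun x => c + prim h x) :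
    2 * (⟪mulX f, h⟫_ℂ).re = ‖c + prim h 1‖ ^ 2 - ‖f‖ ^ 2 := by
  have a1 := absolutelyContinuousOnInterval_const_add_prim c h
  have a2 := absolutelyContinuousOnInterval_conj a1
  have a0 : AbsolutelyContinuousOnInterval (fun x : ℝ => (x : ℂ)) 0 1 :=
    (Complex.ofRealCLM.contDiff (n := 1)).contDiffOn.absolutelyContinuousOnInterval
  have hi1 := intervalIntegrable_L2 h one_mem
  have hi2 : IntervalIntegrable (fun x => (starRingEnd ℂ) (h x)) volume 0 1 :=
    ⟨Complex.conjCLE.integrable_comp_iff.2 hi1.1, Complex.conjCLE.integrable_comp_iff.2 hi1.2⟩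
  set F : ℝ → ℂ := fun x => c + prim h x with hF
  have key := integral_eq_sub_of_absolutelyContinuous
    (f := fun x : ℝ => (1 * (starRingEnd ℂ) (F x) + (x : ℂ) * (starRingEnd ℂ) (h x)) * F x
      + ((x : ℂ) * (starRingEnd ℂ) (F x)) * h x) ((a0.smul a2).smul a1)
    (by
      have c1 := a1.continuousOn
      have c2 := a2.continuousOn
      have c0 := a0.continuousOn
      have j1 : IntervalIntegrable (fun x => 1 * (starRingEnd ℂ) (F x)) volume 0 1 :=
        (continuousOn_const.mul c2).intervalIntegrable
      exact ((j1.add (hi2.continuousOn_mul c0)).mul_continuousOn c1).add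
        (hi1.continuousOn_mul (c0.mul c2))) (by
      filter_upwards [ae_hasDerivAt_const_add_prim c h] with x h1 hx
      have hx0 : HasDerivAt (fun x : ℝ => (x : ℂ)) 1 x := Complex.ofRealCLM.hasDerivAt
      exact (hx0.mul (hasDerivAt_conj (h1 hx))).mul (h1 hx))
  have e : ∫ x in (0 : ℝ)..1, (⟪f x, f x⟫_ℂ + (⟪h x, mulX f x⟫_ℂ + ⟪mulX f x, h x⟫_ℂ))
      = ∫ x in (0 : ℝ)..1, ((1 * (starRingEnd ℂ) (F x) + (x : ℂ) * (starRingEnd ℂ) (h x)) * F x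
      + ((x : ℂ) * (starRingEnd ℂ) (F x)) * h x) := by
    refine intervalIntegral.integral_congr_ae (ae_of_ae_unitMeasure ?_)
    filter_upwards [hf, mulX_ae f] with x h1 h2
    rw [h2, h1]; simp only [RCLike.inner_apply, map_mul, Complex.conj_ofReal]; ring
  rw [key, ← integral_unitMeasure, integral_add (L2.integrable_inner _ _)
    ((L2.integrable_inner _ _).add (L2.integrable_inner _ _)),
    integral_add (L2.integrable_inner _ _) (L2.integrable_inner _ _), ← L2.inner_def,
    ← L2.inner_def, ← L2.inner_def] at e
  have e2 := congrArg Complex.re e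
  have e6 : (((fun x : ℝ => (x : ℂ)) • fun x => (starRingEnd ℂ) (c + prim h x)) • F) 1
      - (((fun x : ℝ => (x : ℂ)) • fun x => (starRingEnd ℂ) (c + prim h x)) • F) 0
      = (starRingEnd ℂ) (F 1) * F 1 := by
    simp [hF, Pi.smul_apply']
  rw [e6] at e2
  simp only [Complex.add_re] at e2
  have e3 : (⟪h, mulX f⟫_ℂ).re = (⟪mulX f, h⟫_ℂ).re := inner_re_symm (𝕜 := ℂ) _ _
  have e4 : (⟪f, f⟫_ℂ).re = ‖f‖ ^ 2 := inner_self_eq_norm_sq (𝕜 := ℂ) f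
  have e5 : ((starRingEnd ℂ) (F 1) * F 1).re = ‖F 1‖ ^ 2 := by
    rw [mul_comm, Complex.mul_conj, Complex.normSq_eq_norm_sq, Complex.ofReal_re]
  rw [e3, e4, e5] at e2
  simp only [hF] at e2
  linarith

/-! ### The characteristic equation -/

theorem isEigenvalue_gen_iff {N : ℕ} {A D : Matrix (Fin N) (Fin N) ℂ} {μ : ℂ} :
    IsEigenvalue (gen A D) μ ↔ ∃ z : State N, z ≠ 0 ∧ (z, μ • z) ∈ genGraph A D := by
  constructor
  · rintro ⟨z, hz, h⟩
    refine ⟨z, hz, ?_⟩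
    rw [← gen_graph, ← h]
    exact (gen A D).mem_graph z
  · rintro ⟨z, hz, h⟩
    rw [← gen_graph, LinearPMap.mem_graph_iff] at h
    obtain ⟨w, hw, hw2⟩ := h
    simp only at hw hw2
    subst hw
    exact ⟨w, hz, hw2⟩

/-- The graph of the generator of the example, component by component. -/
theorem mem_genGraph_iff {z y : State 2} : (z, y) ∈ genGraph matA matD ↔
    (z.snd 0 = toL2 (y.fst 0) ∧ z.snd 1 = toL2 (y.fst 1)) ∧
    (∀ φ : H1, ⟪der φ, der (z.fst 0)⟫_ℂ + ⟪toL2 φ, y.snd 0 + toL2 (z.fst 0)⟫_ℂ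
      + (trace (y.fst 0) - trace (y.fst 1)) * (starRingEnd ℂ) (trace φ) = 0) ∧
    (∀ φ : H1, ⟪der φ, der (z.fst 1)⟫_ℂ + ⟪toL2 φ, y.snd 1⟫_ℂ
      + (trace (y.fst 1) - trace (y.fst 0)) * (starRingEnd ℂ) (trace φ) = 0) := by
  constructor
  · rintro ⟨h1, h2⟩
    refine ⟨⟨h1 0, h1 1⟩, fun φ => ?_, fun φ => ?_⟩
    · have := h2 ![φ, 0]
      simp [form, matA, matD, Fin.sum_univ_two] at this
      rw [inner_add_right]
      linear_combination this
    · have := h2 ![0, φ]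
      simp [form, matA, matD, Fin.sum_univ_two] at this
      linear_combination this
  · rintro ⟨h1, h2, h3⟩
    refine ⟨fun i => ?_, fun Φ => ?_⟩
    · fin_cases i
      · exact h1.1
      · exact h1.2
    · have e1 := h2 (Φ 0)
      have e2 := h3 (Φ 1)
      rw [inner_add_right] at e1
      simp [form, matA, matD, Fin.sum_univ_two]
      linear_combination e1 + e2

/-- The solutions of `f'' = s² f`, `f(0) = 0`, `f'(0) = c` satisfy `f' + s f = c e^{s x}`. -/
theorem deriv_add_smul_eq_exp {f : H1} {c s : ℂ}
    (hf : der f =ᵐ[unitMeasure] fun x => c + prim (s ^ 2 • toL2 f) x) {x : ℝ}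
    (hx : x ∈ Icc (0 : ℝ) 1) :
    (c + prim (s ^ 2 • toL2 f) x) + s * prim (der f) x = c * Complex.exp (s * x) := by
  have a1 := absolutelyContinuousOnInterval_const_add_prim c (s ^ 2 • toL2 f)
  have a2 := absolutelyContinuousOnInterval_const_add_prim 0 (der f)
  have hexp : ContDiff ℝ 1 fun x : ℝ => Complex.exp (-s * x) :=
    Complex.contDiff_exp.comp (contDiff_const.mul Complex.ofRealCLM.contDiff)
  have a0 : AbsolutelyContinuousOnInterval (fun x : ℝ => Complex.exp (-s * x)) 0 1 :=
    hexp.contDiffOn.absolutelyContinuousOnInterval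
  have hae : ∀ᵐ x : ℝ, x ∈ uIoc (0 : ℝ) 1 → der f x = c + prim (s ^ 2 • toL2 f) x ∧
      (s ^ 2 • toL2 f : L2) x = s ^ 2 * prim (der f) x := by
    refine ae_of_ae_unitMeasure ?_
    filter_upwards [hf, toL2_ae f, Lp.coeFn_smul (s ^ 2) (toL2 f)] with x h1 h2 h3
    refine ⟨h1, ?_⟩
    rw [h3, Pi.smul_apply, h2, smul_eq_mul]
  -- `e^{-s x} (f' + s f)` has derivative zero
  obtain ⟨C, hC⟩ := (a0.smul (a1.add (a2.const_smul s))).const_of_ae_hasDerivAt_zero (by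
    filter_upwards [ae_hasDerivAt_const_add_prim c (s ^ 2 • toL2 f),
      ae_hasDerivAt_const_add_prim 0 (der f), hae, show ∀ᵐ x : ℝ, x ≠ 0 by
        simp [ae_iff, measure_singleton]] with x h1 h2 h3 h0 hx
    have hx' : x ∈ uIoc (0 : ℝ) 1 := by
      rw [uIcc_of_le zero_le_one] at hx
      rw [uIoc_of_le zero_le_one]
      exact ⟨lt_of_le_of_ne hx.1 (Ne.symm h0), hx.2⟩
    have hx0 : HasDerivAt (fun x : ℝ => Complex.exp (-s * x)) (Complex.exp (-s * x) * (-s)) x := by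
      have : HasDerivAt (fun x : ℝ => -s * (x : ℂ)) (-s) x := by
        simpa using (Complex.ofRealCLM.hasDerivAt (x := x)).const_mul (-s)
      exact this.cexp
    have := hx0.mul ((h1 hx).add ((h2 hx).const_mul s))
    refine this.congr_deriv ?_
    rw [(h3 hx').2, (h3 hx').1]
    simp only [Pi.add_apply]
    rw [(h3 hx').1.symm]
    ring)
  have e1 := hC x (by rwa [uIcc_of_le zero_le_one])
  have e0 := hC 0 left_mem_uIcc
  have p0 : ∀ g : L2, prim g 0 = 0 := fun g => by simp [prim]
  simp only [Pi.smul_apply', Pi.add_apply, smul_eq_mul, p0, Complex.ofReal_zero,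
    mul_zero, Complex.exp_zero, add_zero, one_mul, zero_add] at e1 e0
  rw [← e0] at e1
  calc _ = Complex.exp (s * x) * (Complex.exp (-s * x) * ((c + prim (s ^ 2 • toL2 f) x)
        + s * prim (der f) x)) := by
        rw [← mul_assoc, ← Complex.exp_add]; simp
    _ = _ := by rw [e1, mul_comm]

/-- The solutions of `f'' = s² f`, `f(0) = 0` are the multiples of `sinh (s x)`. -/
theorem prim_der_eq_sinh {f : H1} {c s : ℂ}
    (hf : der f =ᵐ[unitMeasure] fun x => c + prim (s ^ 2 • toL2 f) x) {x : ℝ}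
    (hx : x ∈ Icc (0 : ℝ) 1) :
    s * prim (der f) x = c * Complex.sinh (s * x) ∧
      c + prim (s ^ 2 • toL2 f) x = c * Complex.cosh (s * x) := by
  have h1 := deriv_add_smul_eq_exp hf hx
  have h2 := deriv_add_smul_eq_exp (s := -s) (by rwa [neg_sq]) hx
  rw [neg_sq] at h2
  rw [Complex.sinh, Complex.cosh, ← neg_mul]
  constructor
  · linear_combination (h1 - h2) / 2
  · linear_combination (h1 + h2) / 2

theorem exists_coe_ae_eq {f : ℝ → ℂ} (hf : Continuous f) :
    ∃ g : L2, g =ᵐ[unitMeasure] f :=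
  ⟨(memLp_of_continuousOn hf.continuousOn).toLp, MemLp.coeFn_toLp _⟩

theorem prim_eq_sub_of_hasDerivAt {F f : ℝ → ℂ} {g : L2} (hg : g =ᵐ[unitMeasure] f)
    (hf : Continuous f) (hF : ∀ x, HasDerivAt F (f x) x) {x : ℝ} (hx : x ∈ Icc (0 : ℝ) 1) :
    prim g x = F x - F 0 := by
  rw [prim_congr hg hx, intervalIntegral.integral_eq_sub_of_hasDerivAt (fun y _ => hF y)
    (hf.intervalIntegrable _ _)]

/-- The function `sinh (s x)` as an element of `H₁`, with the weak form of `f'' = s² f`. -/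
theorem exists_sinh (s : ℂ) : ∃ f : H1, trace f = Complex.sinh s ∧ (s ≠ 0 → f ≠ 0) ∧
    ∀ φ : H1, ⟪der φ, der f⟫_ℂ + ⟪toL2 φ, s ^ 2 • toL2 f⟫_ℂ
      = s * Complex.cosh s * (starRingEnd ℂ) (trace φ) := by
  have hlin : ∀ x : ℝ, HasDerivAt (fun x : ℝ => s * (x : ℂ)) s x := fun x => by
    simpa using (Complex.ofRealCLM.hasDerivAt (x := x)).const_mul s
  have hcl : Continuous fun x : ℝ => s * (x : ℂ) := by fun_prop
  have hs : ∀ x : ℝ,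
      HasDerivAt (fun x : ℝ => Complex.sinh (s * x)) (s * Complex.cosh (s * x)) x := by
    intro x
    have := HasDerivAt.comp x (Complex.hasDerivAt_sinh (s * x)) (hlin x)
    rwa [mul_comm] at this
  have hc : ∀ x : ℝ, HasDerivAt (fun x : ℝ => s * Complex.cosh (s * x))
      (s ^ 2 * Complex.sinh (s * x)) x := by
    intro x
    have := (HasDerivAt.comp x (Complex.hasDerivAt_cosh (s * x)) (hlin x)).const_mul s
    exact this.congr_deriv (by ring)
  have hcc : Continuous fun x : ℝ => s * Complex.cosh (s * x) :=
    continuous_const.mul (Complex.continuous_cosh.comp hcl)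
  have hsc : Continuous fun x : ℝ => s ^ 2 * Complex.sinh (s * x) :=
    continuous_const.mul (Complex.continuous_sinh.comp hcl)
  obtain ⟨g, hg⟩ := exists_coe_ae_eq hcc
  have hp : ∀ x ∈ Icc (0 : ℝ) 1, prim g x = Complex.sinh (s * x) := fun x hx => by
    rw [prim_eq_sub_of_hasDerivAt hg hcc hs hx]; simp
  have hh : (s ^ 2 • toL2 (ofDer g) : L2)
      =ᵐ[unitMeasure] fun x => s ^ 2 * Complex.sinh (s * x) := by
    filter_upwards [toL2_ae (ofDer g), Lp.coeFn_smul (s ^ 2) (toL2 (ofDer g)), ae_mem_Icc]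
      with x h1 h2 hx
    rw [h2, Pi.smul_apply, h1, smul_eq_mul, der_ofDer, hp x hx]
  have hph : ∀ x ∈ Icc (0 : ℝ) 1, s + prim (s ^ 2 • toL2 (ofDer g)) x
      = s * Complex.cosh (s * x) := fun x hx => by
    rw [prim_eq_sub_of_hasDerivAt hh hsc hc hx]; simp
  refine ⟨ofDer g, ?_, ?_, fun φ => ?_⟩
  · change prim g 1 = _
    simpa using hp 1 one_mem
  · intro h0 hf
    have hg0 : g = 0 := by rw [← der_ofDer g, hf, map_zero]
    have hz : ∀ x ∈ Icc (0 : ℝ) 1, Complex.sinh (s * x) = 0 := fun x hx => by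
      have h1 : (g : ℝ → ℂ) =ᵐ[unitMeasure] 0 := by rw [hg0]; exact Lp.coeFn_zero ℂ 2 unitMeasure
      rw [← hp x hx, prim_congr h1 hx]; simp
    have d1 : HasDerivWithinAt (fun x : ℝ => Complex.sinh (s * x)) s (Icc 0 1) 0 := by
      simpa using (hs 0).hasDerivWithinAt (s := Icc (0 : ℝ) 1)
    have d2 : HasDerivWithinAt (fun x : ℝ => Complex.sinh (s * x)) 0 (Icc 0 1) 0 :=
      (hasDerivWithinAt_const 0 (Icc (0 : ℝ) 1) (0 : ℂ)).congr hz (hz 0 ⟨le_rfl, zero_le_one⟩)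
    exact h0 ((uniqueDiffOn_Icc zero_lt_one 0 ⟨le_rfl, zero_le_one⟩).eq_deriv _ d1 d2)
  · rw [inner_der_add_inner_toL2 φ (c := s), hph 1 one_mem]
    · simp
    · rw [der_ofDer]
      filter_upwards [hg, ae_mem_Icc] with x h1 hx
      rw [h1, hph x hx]

/-- A nonzero `b` is an eigenvalue exactly when the boundary conditions for
`(a₁ sinh (b₁ x), a₂ sinh (b x))` have a nontrivial solution; the determinant of this linear
system in `(a₁, a₂)` is `b²` times the characteristic function. -/
theorem isEigenvalue_exGen_iff {b b₁ : ℂ} (hb : b ≠ 0) (hb₁ : b₁ ≠ 0) (h : b₁ ^ 2 = b ^ 2 + 1) :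
    IsEigenvalue exGen b ↔
      b₁ / b * Complex.cosh b₁ * (Complex.sinh b + Complex.cosh b)
          + Complex.cosh b * Complex.sinh b₁ = 0 := by
  have hchar : (b₁ / b * Complex.cosh b₁ * (Complex.sinh b + Complex.cosh b)
          + Complex.cosh b * Complex.sinh b₁) * b =
      (b₁ * Complex.cosh b₁ + b * Complex.sinh b₁) * (Complex.sinh b + Complex.cosh b)
        - b * Complex.sinh b * Complex.sinh b₁ := by
    field_simp; ring
  rw [exGen, isEigenvalue_gen_iff]
  constructor
  · rintro ⟨z, hz, hzg⟩
    obtain ⟨⟨h1, h2⟩, h3, h4⟩ := mem_genGraph_iff.1 hzg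
    simp only [WithLp.smul_fst, PiLp.smul_apply, map_smul] at h1 h2
    simp only [WithLp.smul_fst, WithLp.smul_snd, PiLp.smul_apply, map_smul, h1, h2,
      smul_eq_mul] at h3 h4
    set u := z.fst 0
    set v := z.fst 1
    have e1 : b • b • toL2 u + toL2 u = b₁ ^ 2 • toL2 u := by
      rw [h, add_smul, one_smul, smul_smul, sq]
    have e2 : b • b • toL2 v = b ^ 2 • toL2 v := by rw [smul_smul, sq]
    rw [e1] at h3
    rw [e2] at h4
    have s1 := ae_eq_of_weak h3
    have s2 := ae_eq_of_weak h4
    set c₁ := -(b * trace u - b * trace v) - prim (b₁ ^ 2 • toL2 u) 1 with hc₁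
    set c₂ := -(b * trace v - b * trace u) - prim (b ^ 2 • toL2 v) 1 with hc₂
    obtain ⟨p1, p2⟩ := prim_der_eq_sinh s1 one_mem
    obtain ⟨q1, q2⟩ := prim_der_eq_sinh s2 one_mem
    simp only [Complex.ofReal_one, mul_one] at p1 p2 q1 q2
    change b₁ * trace u = _ at p1
    change b * trace v = _ at q1
    have r1 : c₁ * (b₁ * Complex.cosh b₁ + b * Complex.sinh b₁) = c₂ * (b₁ * Complex.sinh b) := by
      linear_combination b₁ * hc₁ - b₁ * p2 + b₁ * q1 - b * p1
    have r2 : c₂ * (Complex.sinh b + Complex.cosh b) * b₁ = c₁ * (b * Complex.sinh b₁) := by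
      linear_combination b₁ * hc₂ - b₁ * q2 + b * p1 - b₁ * q1
    by_contra hne
    have hdet : (b₁ * Complex.cosh b₁ + b * Complex.sinh b₁) * (Complex.sinh b + Complex.cosh b)
        - b * Complex.sinh b * Complex.sinh b₁ ≠ 0 := by
      rw [← hchar]; exact mul_ne_zero hne hb
    have k1 : c₁ = 0 := by
      have : c₁ * ((b₁ * Complex.cosh b₁ + b * Complex.sinh b₁) * (Complex.sinh b + Complex.cosh b)
          - b * Complex.sinh b * Complex.sinh b₁) = 0 := by
        linear_combination (Complex.sinh b + Complex.cosh b) * r1 + Complex.sinh b * r2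
      exact (mul_eq_zero.1 this).resolve_right hdet
    have k2 : c₂ = 0 := by
      have : c₂ * b₁ * ((b₁ * Complex.cosh b₁ + b * Complex.sinh b₁) *
          (Complex.sinh b + Complex.cosh b) - b * Complex.sinh b * Complex.sinh b₁) = 0 := by
        linear_combination (b₁ * Complex.cosh b₁ + b * Complex.sinh b₁) * r2
          + b * Complex.sinh b₁ * r1
      exact (mul_eq_zero.1 ((mul_eq_zero.1 this).resolve_right hdet)).resolve_right hb₁
    have zero_of : ∀ {f : H1} {s c : ℂ}, s ≠ 0 → c = 0 →
        (der f =ᵐ[unitMeasure] fun x => c + prim (s ^ 2 • toL2 f) x) → f = 0 := by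
      intro f s c hs hc hf
      refine H1_ext_of_toL2 ((Lp.eq_zero_iff_ae_eq_zero).2 ?_)
      filter_upwards [toL2_ae f, ae_mem_Icc] with x hx hxI
      have := (prim_der_eq_sinh hf hxI).1
      rw [hc, zero_mul] at this
      rw [hx]; exact (mul_eq_zero.1 this).resolve_left hs
    have u0 : u = 0 := zero_of hb₁ k1 s1
    have v0 : v = 0 := zero_of hb k2 s2
    refine hz (WithLp.ofLp_injective 2 (Prod.ext ?_ ?_))
    · change z.fst = 0
      ext1 i; fin_cases i
      · exact u0
      · exact v0
    · change z.snd = 0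
      ext1 i; fin_cases i
      · change z.snd 0 = 0; rw [h1, u0]; simp
      · change z.snd 1 = 0; rw [h2, v0]; simp
  · intro hE
    rw [hE, zero_mul] at hchar
    obtain ⟨f, ft, f0, hf⟩ := exists_sinh b₁
    obtain ⟨g, gt, -, hg⟩ := exists_sinh b
    set a : ℂ := Complex.exp b with ha
    -- the second boundary condition reads `a₁ sinh b₁ = a₂ e^b`, so `(a₁, a₂) = (e^b, sinh b₁)`
    let z : State 2 := WithLp.toLp 2 (WithLp.toLp 2 ![a • f, Complex.sinh b₁ • g],
      WithLp.toLp 2 ![b • toL2 (a • f), b • toL2 (Complex.sinh b₁ • g)])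
    have z1 : z.fst 0 = a • f := rfl
    have z2 : z.fst 1 = Complex.sinh b₁ • g := rfl
    have z3 : z.snd 0 = b • toL2 (a • f) := rfl
    have z4 : z.snd 1 = b • toL2 (Complex.sinh b₁ • g) := rfl
    have hab : a = Complex.sinh b + Complex.cosh b := by
      rw [ha, Complex.sinh_add_cosh]
    refine ⟨z, ?_, mem_genGraph_iff.2 ⟨?_, fun φ => ?_, fun φ => ?_⟩⟩
    · intro hz
      have : a • f = 0 := by rw [← z1, hz]; rfl
      rcases smul_eq_zero.1 this with h0 | h0
      · exact Complex.exp_ne_zero b h0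
      · exact f0 hb₁ h0
    · simp only [WithLp.smul_fst, PiLp.smul_apply, z1, z2, z3, z4, map_smul]
      exact ⟨trivial, trivial⟩
    · simp only [WithLp.smul_fst, WithLp.smul_snd, PiLp.smul_apply, z1, z2, z3, map_smul, ft, gt,
        smul_eq_mul]
      have e1 : b • b • a • toL2 f + a • toL2 f = a • b₁ ^ 2 • toL2 f := by
        rw [h, smul_smul, smul_smul, smul_smul, ← add_smul]; congr 1; ring
      rw [e1, inner_smul_right, inner_smul_right]
      linear_combination a * hf φ - (starRingEnd ℂ) (trace φ) * (hchar
        - (b₁ * Complex.cosh b₁ + b * Complex.sinh b₁) * hab)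
    · simp only [WithLp.smul_fst, WithLp.smul_snd, PiLp.smul_apply, z1, z2, z4, map_smul, ft, gt,
        smul_eq_mul]
      have e1 : b • b • Complex.sinh b₁ • toL2 g = Complex.sinh b₁ • b ^ 2 • toL2 g := by
        rw [smul_smul, smul_smul, smul_smul]; congr 1; ring
      rw [e1, inner_smul_right, inner_smul_right]
      linear_combination Complex.sinh b₁ * hg φ
        - (starRingEnd ℂ) (trace φ) * b * Complex.sinh b₁ * hab

/-! ### Asymptotics of the eigenvalues -/

/-- Persistence of a simple zero, with Newton's error bound: if `a` is an approximate zero of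
`H(·, τ)`, then there is a zero `ψ` whose distance to `a` is `O(H(a, τ))`. -/
theorem exists_zero_of_simple_zero {H : ℂ × ℂ → ℂ} {m : ℂ} (hH : AnalyticAt ℂ H 0)
    (h0 : H 0 = 0) (hm : HasDerivAt (fun w => H (w, 0)) m 0) (hm0 : m ≠ 0)
    {ι : Type*} {l : Filter ι} {τ a : ι → ℂ} (hτ : Tendsto τ l (𝓝 0)) (ha : Tendsto a l (𝓝 0)) :
    ∃ ψ : ι → ℂ, Tendsto ψ l (𝓝 0) ∧ (∀ᶠ n in l, H (ψ n, τ n) = 0) ∧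
      (fun n => ψ n - a n) =O[l] fun n => H (a n, τ n) := by
  have hs := hH.hasStrictFDerivAt
  set L := fderiv ℂ H 0
  have hLm : L (1, 0) = m := by
    have h1 : HasDerivAt (fun w : ℂ => ((w, 0) : ℂ × ℂ)) (1, 0) 0 :=
      (hasDerivAt_id 0).prodMk (hasDerivAt_const 0 0)
    exact (HasFDerivAt.comp_hasDerivAt (f := fun w : ℂ => ((w, 0) : ℂ × ℂ)) (0 : ℂ)
      hs.hasFDerivAt h1).unique hm
  have hL : ∀ p : ℂ × ℂ, L p = m * p.1 + L (0, p.2) := fun p => by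
    have : p = p.1 • ((1, 0) : ℂ × ℂ) + (0, p.2) := by ext <;> simp
    conv_lhs => rw [this]
    rw [map_add, map_smul, hLm, smul_eq_mul, mul_comm]
  -- `(w, τ) ↦ (H (w, τ), τ)` has an invertible derivative, hence a local inverse that is Lipschitz
  let f₁ : ℂ × ℂ →L[ℂ] ℂ × ℂ := L.prod (ContinuousLinearMap.snd ℂ ℂ ℂ)
  let f₂ : ℂ × ℂ →L[ℂ] ℂ × ℂ := (m⁻¹ • (ContinuousLinearMap.fst ℂ ℂ ℂ -
    L.comp ((0 : ℂ × ℂ →L[ℂ] ℂ).prod (ContinuousLinearMap.snd ℂ ℂ ℂ)))).prod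
      (ContinuousLinearMap.snd ℂ ℂ ℂ)
  let e : (ℂ × ℂ) ≃L[ℂ] (ℂ × ℂ) := ContinuousLinearEquiv.equivOfInverse f₁ f₂
    (fun p => by
      ext
      · simp only [f₁, f₂, ContinuousLinearMap.prod_apply, _root_.smul_apply,
          sub_apply, ContinuousLinearMap.comp_apply,
          ContinuousLinearMap.coe_fst', ContinuousLinearMap.coe_snd',
          zero_apply, smul_eq_mul]
        rw [hL p]; field_simp; ring
      · rfl)
    (fun p => by
      ext
      · simp only [f₁, f₂, ContinuousLinearMap.prod_apply, _root_.smul_apply,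
          sub_apply, ContinuousLinearMap.comp_apply,
          ContinuousLinearMap.coe_fst', ContinuousLinearMap.coe_snd',
          zero_apply, smul_eq_mul]
        rw [hL]; simp only; field_simp; ring
      · rfl)
  let Φ : ℂ × ℂ → ℂ × ℂ := fun p => (H p, p.2)
  have hΦ : HasStrictFDerivAt Φ (e : ℂ × ℂ →L[ℂ] ℂ × ℂ) 0 :=
    hs.prodMk (ContinuousLinearMap.snd ℂ ℂ ℂ).hasStrictFDerivAt
  have hΦ0 : Φ 0 = 0 := by simp [Φ, h0]
  set g := hΦ.localInverse Φ e 0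
  have hg := hΦ.to_localInverse.isBigO_sub
  have hgt : Tendsto g (𝓝 0) (𝓝 0) := by
    have := hΦ.localInverse_tendsto
    rwa [hΦ0] at this
  have hr : ∀ᶠ y in 𝓝 (0 : ℂ × ℂ), Φ (g y) = y := by
    have := hΦ.eventually_right_inverse
    rwa [hΦ0] at this
  have hl : ∀ᶠ x in 𝓝 (0 : ℂ × ℂ), g (Φ x) = x := hΦ.eventually_left_inverse
  rw [hΦ0] at hg
  have t1 : Tendsto (fun n => ((0, τ n) : ℂ × ℂ)) l (𝓝 0) :=
    tendsto_const_nhds.prodMk_nhds hτ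
  have t2 : Tendsto (fun n => ((a n, τ n) : ℂ × ℂ)) l (𝓝 0) := ha.prodMk_nhds hτ
  have t3 : Tendsto (fun n => Φ (a n, τ n)) l (𝓝 0) := by
    have : ContinuousAt Φ 0 := hΦ.hasFDerivAt.continuousAt
    have := this.tendsto.comp t2
    rwa [hΦ0] at this
  refine ⟨fun n => (g (0, τ n)).1, ?_, ?_, ?_⟩
  · exact (continuous_fst.tendsto (0 : ℂ × ℂ)).comp (hgt.comp t1)
  · filter_upwards [t1.eventually hr] with n hn
    have e1 : (g (0, τ n)).2 = τ n := congrArg Prod.snd hn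
    have e2 : H (g (0, τ n)) = 0 := congrArg Prod.fst hn
    rw [← e1, e1]
    rw [show ((g (0, τ n)).1, τ n) = g (0, τ n) from Prod.ext rfl e1.symm]
    exact e2
  · have h1 := hg.comp_tendsto (t1.prodMk_nhds t3)
    have h2 : (fun n => ((0, τ n) : ℂ × ℂ) - Φ (a n, τ n)) =O[l] fun n => H (a n, τ n) := by
      refine IsBigO.of_bound 1 (Eventually.of_forall fun n => ?_)
      simp [Φ, Prod.norm_def]
    have h3 := IsBigO.trans h1 h2
    refine IsBigO.trans (IsBigO.of_bound 1 ?_) h3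
    filter_upwards [t2.eventually hl] with n hn
    change _ ≤ 1 * ‖g (0, τ n) - g (Φ (a n, τ n))‖
    rw [hn, one_mul]
    exact norm_fst_le (g (0, τ n) - (a n, τ n))

/-- The branch of `√(1 + σ²)` with value `1` at `σ = 0`; for `σ = 1/β` it is `β₁/β`. -/
def sqrtOneAdd (σ : ℂ) : ℂ := Complex.exp (Complex.log (1 + σ ^ 2) / 2)

/-- The difference `β₁ - β`, as a function of `σ = 1/β`. -/
def rootShift (σ : ℂ) : ℂ := σ / (sqrtOneAdd σ + 1)

/-- The characteristic function at `β ∈ y + iπℤ`, as a function of `y` and `σ = 1/β`. -/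
def charFun (y σ : ℂ) : ℂ :=
  sqrtOneAdd σ * Complex.cosh (y + rootShift σ) * Complex.exp y
    + Complex.cosh y * Complex.sinh (y + rootShift σ)

/-- The value of `1/β` at `β = 1/τ + w`. -/
def invShift (w τ : ℂ) : ℂ := τ / (1 + τ * w)

theorem sqrtOneAdd_zero : sqrtOneAdd 0 = 1 := by simp [sqrtOneAdd]

theorem rootShift_zero : rootShift 0 = 0 := by simp [rootShift]

theorem sqrtOneAdd_sq {σ : ℂ} (h : 1 + σ ^ 2 ≠ 0) : sqrtOneAdd σ ^ 2 = 1 + σ ^ 2 := by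
  rw [sqrtOneAdd, ← Complex.exp_nat_mul]
  rw [show ((2 : ℕ) : ℂ) * (Complex.log (1 + σ ^ 2) / 2) = Complex.log (1 + σ ^ 2) by
    push_cast; ring, Complex.exp_log h]

theorem analyticAt_sqrtOneAdd : AnalyticAt ℂ sqrtOneAdd 0 := by
  have h1 : AnalyticAt ℂ (fun σ : ℂ => 1 + σ ^ 2) 0 := by fun_prop
  have h2 : AnalyticAt ℂ (fun σ : ℂ => Complex.log (1 + σ ^ 2)) 0 :=
    h1.clog (by simp)
  exact (h2.div analyticAt_const two_ne_zero).cexp'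

theorem analyticAt_rootShift : AnalyticAt ℂ rootShift 0 := by
  refine analyticAt_id.div (analyticAt_sqrtOneAdd.add analyticAt_const) ?_
  rw [sqrtOneAdd_zero]; norm_num

theorem analyticAt_charFun (y₀ : ℂ) :
    AnalyticAt ℂ (fun p : ℂ × ℂ => charFun (y₀ + p.1) (invShift p.1 p.2)) 0 := by
  have hσ : AnalyticAt ℂ (fun p : ℂ × ℂ => invShift p.1 p.2) 0 := by
    refine analyticAt_snd.div (analyticAt_const.add (analyticAt_snd.mul analyticAt_fst)) ?_
    simp
  have hr : AnalyticAt ℂ (fun p : ℂ × ℂ => sqrtOneAdd (invShift p.1 p.2)) 0 :=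
    AnalyticAt.fun_comp (g := sqrtOneAdd) (by simpa [invShift] using analyticAt_sqrtOneAdd) hσ
  have hd : AnalyticAt ℂ (fun p : ℂ × ℂ => rootShift (invShift p.1 p.2)) 0 :=
    AnalyticAt.fun_comp (g := rootShift) (by simpa [invShift] using analyticAt_rootShift) hσ
  have hy : AnalyticAt ℂ (fun p : ℂ × ℂ => y₀ + p.1) 0 := analyticAt_const.add analyticAt_fst
  exact ((hr.mul (AnalyticAt.fun_comp Complex.analyticAt_cosh (hy.add hd))).mul hy.cexp').add
    ((AnalyticAt.fun_comp Complex.analyticAt_cosh hy).mul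
      (AnalyticAt.fun_comp Complex.analyticAt_sinh (hy.add hd)))

theorem hasDerivAt_charFun (y₀ : ℂ) :
    HasDerivAt (fun w => charFun (y₀ + w) (invShift w 0))
      (Complex.exp (2 * y₀) + Complex.cosh (2 * y₀)) 0 := by
  have e : (fun w => charFun (y₀ + w) (invShift w 0)) = fun w =>
      Complex.cosh (y₀ + w) * Complex.exp (y₀ + w)
        + Complex.cosh (y₀ + w) * Complex.sinh (y₀ + w) := by
    funext w
    simp [charFun, invShift, sqrtOneAdd_zero, rootShift_zero]
  have hw : HasDerivAt (fun w : ℂ => y₀ + w) 1 0 := (hasDerivAt_id 0).const_add y₀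
  rw [e]
  refine ((hw.ccosh.mul hw.cexp).add (hw.ccosh.mul hw.csinh)).congr_deriv ?_
  simp only [add_zero, mul_one]
  rw [two_mul, Complex.exp_add, Complex.cosh_add, ← Complex.sinh_add_cosh]
  ring

/-- The zeros of `charFun` give eigenvalues: translation by `n π i` multiplies each hyperbolic
function in the characteristic equation by the same factor `cosh (n π i) = ±1`. -/
theorem isEigenvalue_of_charFun_eq_zero {w τ y₀ : ℂ} {n : ℕ} (hτ : τ ≠ 0)
    (h1 : 1 + τ * w ≠ 0) (h2 : 1 + invShift w τ ^ 2 ≠ 0) (h3 : sqrtOneAdd (invShift w τ) + 1 ≠ 0)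
    (hy : 1 / τ = y₀ + n * (Real.pi * Complex.I))
    (h : charFun (y₀ + w) (invShift w τ) = 0) : IsEigenvalue exGen (1 / τ + w) := by
  set σ := invShift w τ with hσ
  set β := 1 / τ + w with hβ
  have hβσ : β * σ = 1 := by
    rw [hβ, hσ, invShift]; field_simp
  have hβ0 : β ≠ 0 := left_ne_zero_of_mul_eq_one hβσ
  have hσ0 : σ ≠ 0 := right_ne_zero_of_mul_eq_one hβσ
  have hr := sqrtOneAdd_sq h2
  have hr0 : sqrtOneAdd σ ≠ 0 := Complex.exp_ne_zero _
  have hshift : β * sqrtOneAdd σ = β + rootShift σ := by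
    have : σ * (β * sqrtOneAdd σ) = σ * (β + rootShift σ) := by
      rw [rootShift]; field_simp
      linear_combination σ * hβσ + β * hr
    exact mul_left_cancel₀ hσ0 this
  have hsq : (β * sqrtOneAdd σ) ^ 2 = β ^ 2 + 1 := by
    rw [mul_pow, hr]; linear_combination (β * σ + 1) * hβσ
  rw [isEigenvalue_exGen_iff hβ0 (mul_ne_zero hβ0 hr0) hsq, mul_div_cancel_left₀ _ hβ0, hshift]
  have hs0 : Complex.sinh (n * (Real.pi * Complex.I)) = 0 := by
    rw [← mul_assoc, Complex.sinh_mul_I, Complex.sin_nat_mul_pi, zero_mul]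
  have hβy : β = (y₀ + w) + n * (Real.pi * Complex.I) := by rw [hβ, hy]; ring
  have hβy2 : β + rootShift σ = (y₀ + w + rootShift σ) + n * (Real.pi * Complex.I) := by
    rw [hβy]; ring
  rw [hβy2, hβy]
  rw [charFun, ← Complex.sinh_add_cosh (y₀ + w)] at h
  generalize y₀ + w + rootShift σ = y₂ at h ⊢
  generalize y₀ + w = y₁ at h ⊢
  simp only [Complex.sinh_add, Complex.cosh_add, hs0, mul_zero, add_zero]
  linear_combination Complex.cosh (n * (Real.pi * Complex.I)) ^ 2 * h

/-- A simple zero `y₀` of the limiting characteristic function `cosh y (e^y + sinh y)` generates a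
sequence of eigenvalues near `y₀ + i n π`; an approximate solution `a` gives their asymptotics. -/
theorem exists_eigenvalues_near {y₀ : ℂ}
    (h0 : Complex.cosh y₀ * (Complex.exp y₀ + Complex.sinh y₀) = 0)
    (h1 : Complex.exp (2 * y₀) + Complex.cosh (2 * y₀) ≠ 0) {τ : ℕ → ℂ} {a : ℕ → ℂ}
    (hτ : Tendsto τ atTop (𝓝 0)) (hτ0 : ∀ n, τ n ≠ 0)
    (hτy : ∀ n : ℕ, 1 / τ n = y₀ + n * (Real.pi * Complex.I)) (ha : Tendsto a atTop (𝓝 0)) :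
    ∃ β : ℕ → ℂ, (∀ n, IsEigenvalue exGen (β n)) ∧
      Tendsto (fun n => β n - 1 / τ n) atTop (𝓝 0) ∧
      (fun n => β n - (1 / τ n + a n)) =O[atTop]
        fun n => charFun (y₀ + a n) (invShift (a n) (τ n)) := by
  obtain ⟨ψ, hψ, hz, hO⟩ := exists_zero_of_simple_zero (analyticAt_charFun y₀)
    (by simp [charFun, invShift, sqrtOneAdd_zero, rootShift_zero]; linear_combination h0)
    (hasDerivAt_charFun y₀) h1 hτ ha
  have hσ : Tendsto (fun n => invShift (ψ n) (τ n)) atTop (𝓝 0) := by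
    have : Tendsto (fun n => τ n / (1 + τ n * ψ n)) atTop (𝓝 (0 / (1 + 0 * 0))) :=
      hτ.div (tendsto_const_nhds.add (hτ.mul hψ)) (by simp)
    rwa [zero_div] at this
  have n1 : ∀ᶠ n in atTop, 1 + τ n * ψ n ≠ 0 := by
    have : Tendsto (fun n => 1 + τ n * ψ n) atTop (𝓝 (1 + 0 * 0)) :=
      tendsto_const_nhds.add (hτ.mul hψ)
    exact this.eventually_ne (by simp)
  have n2 : ∀ᶠ n in atTop, 1 + invShift (ψ n) (τ n) ^ 2 ≠ 0 := by
    have : Tendsto (fun n => 1 + invShift (ψ n) (τ n) ^ 2) atTop (𝓝 (1 + 0 ^ 2)) :=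
      tendsto_const_nhds.add (hσ.pow 2)
    exact this.eventually_ne (by simp)
  have n3 : ∀ᶠ n in atTop, sqrtOneAdd (invShift (ψ n) (τ n)) + 1 ≠ 0 := by
    have := (analyticAt_sqrtOneAdd.continuousAt.tendsto.comp hσ).add_const 1
    refine this.eventually_ne ?_
    rw [sqrtOneAdd_zero]; norm_num
  have hev : ∀ᶠ n in atTop, IsEigenvalue exGen (1 / τ n + ψ n) := by
    filter_upwards [hz, n1, n2, n3] with n k0 k1 k2 k3
    exact isEigenvalue_of_charFun_eq_zero (hτ0 n) k1 k2 k3 (hτy n) k0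
  obtain ⟨N, hN⟩ := eventually_atTop.1 hev
  -- the first `N` terms of the sequence are replaced by the `N`-th one
  refine ⟨fun n => 1 / τ (max n N) + ψ (max n N), fun n => hN _ (le_max_right _ _), ?_, ?_⟩
  · refine hψ.congr' ?_
    filter_upwards [eventually_ge_atTop N] with n hn
    rw [max_eq_left hn]; ring
  · refine IsBigO.congr' hO ?_ (EventuallyEq.refl _ _)
    filter_upwards [eventually_ge_atTop N] with n hn
    rw [max_eq_left hn]; ring

/-! ### Expansion of the characteristic function at `iπ/2` -/

theorem isBigO_sinh_sub_self : (fun z : ℂ => Complex.sinh z - z) =O[𝓝 0] fun z => z ^ 3 := by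
  have h1 := Complex.exp_sub_sum_range_isBigO_pow 3
  have h2 : (fun z : ℂ => Complex.exp (-z) - ∑ i ∈ Finset.range 3, (-z) ^ i / (i.factorial : ℂ))
      =O[𝓝 0] fun z => z ^ 3 := by
    have := h1.comp_tendsto (k := fun z : ℂ => -z) (by
      simpa using (continuous_neg.tendsto (0 : ℂ)))
    refine IsBigO.trans this (IsBigO.of_bound 1 (Eventually.of_forall fun z => ?_))
    simp
  refine ((h1.sub h2).const_mul_left (1 / 2)).congr_left fun z => ?_
  simp [Complex.sinh, Finset.sum_range_succ, Nat.factorial]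
  ring

theorem isBigO_exp_sub_one_sub_self :
    (fun z : ℂ => Complex.exp z - 1 - z) =O[𝓝 0] fun z => z ^ 2 := by
  refine (Complex.exp_sub_sum_range_isBigO_pow 2).congr_left fun z => ?_
  simp [Finset.sum_range_succ]; ring

theorem isBigO_cosh_sub_one : (fun z : ℂ => Complex.cosh z - 1) =O[𝓝 0] fun z => z ^ 2 := by
  have h1 := isBigO_exp_sub_one_sub_self
  have h2 : (fun z : ℂ => Complex.exp (-z) - 1 - (-z)) =O[𝓝 0] fun z => z ^ 2 := by
    have := h1.comp_tendsto (k := fun z : ℂ => -z) (by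
      simpa using (continuous_neg.tendsto (0 : ℂ)))
    refine IsBigO.trans this (IsBigO.of_bound 1 (Eventually.of_forall fun z => ?_))
    simp
  refine ((h1.add h2).const_mul_left (1 / 2)).congr_left fun z => ?_
  simp [Complex.cosh]
  ring

/-- The second-order approximation `-τ/4 + τ²/32` of the zero of the characteristic function. -/
def approxZero (τ : ℂ) : ℂ := -τ / 4 + τ ^ 2 / 32

/-- With `a = approxZero τ` and `σ = 1/β`, the root `sqrtOneAdd σ` is `1 + O(τ²)` and the shift is
`τ/2 + O(τ³)`, so that the characteristic function at `iπ/2 + a` is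
`-((a + τ/2) (1 + a) + a) + O(τ³)`; the choice of `a` cancels the terms in `τ` and `τ²`. -/
theorem charFun_approxZero_isBigO :
    (fun τ => charFun (Real.pi / 2 * Complex.I + approxZero τ) (invShift (approxZero τ) τ))
      =O[𝓝 0] fun τ => τ ^ 3 := by
  have hid : Tendsto (fun τ : ℂ => τ) (𝓝 0) (𝓝 0) := tendsto_id
  have hτ : (fun τ : ℂ => τ) =O[𝓝 0] fun τ => τ := isBigO_refl _ _
  have ha0 : Tendsto approxZero (𝓝 0) (𝓝 0) := by
    have : Continuous approxZero := by unfold approxZero; fun_prop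
    simpa [approxZero] using this.tendsto 0
  have bdd : ∀ {f : ℂ → ℂ} {c : ℂ}, Tendsto f (𝓝 0) (𝓝 c) → f =O[𝓝 0] fun _ => (1 : ℂ) :=
    fun hf => hf.isBigO_one ℂ
  have ha : approxZero =O[𝓝 0] fun τ => τ := by
    have := hτ.mul (bdd (f := fun τ : ℂ => -1 / 4 + τ / 32)
      ((by fun_prop : Continuous fun τ : ℂ => -1 / 4 + τ / 32).tendsto 0))
    exact this.congr (fun τ => by simp only [approxZero]; ring) fun τ => by ring
  set σ : ℂ → ℂ := fun τ => invShift (approxZero τ) τ with hσd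
  have hden : Tendsto (fun τ => 1 + τ * approxZero τ) (𝓝 0) (𝓝 1) := by
    simpa using tendsto_const_nhds.add (hid.mul ha0)
  have hden' : Tendsto (fun τ => (1 + τ * approxZero τ)⁻¹) (𝓝 0) (𝓝 1) := by
    simpa using hden.inv₀ one_ne_zero
  have hσ : σ =O[𝓝 0] fun τ => τ :=
    (hτ.mul (bdd hden')).congr (fun τ => by simp only [hσd, invShift]; rw [div_eq_mul_inv])
      fun τ => by ring
  have hσ0 : Tendsto σ (𝓝 0) (𝓝 0) := hσ.trans_tendsto hid
  have hστ : (fun τ => σ τ - τ) =O[𝓝 0] fun τ => τ ^ 3 := by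
    have h1 : (fun τ => -(σ τ * τ * approxZero τ)) =O[𝓝 0] fun τ => τ ^ 3 :=
      ((hσ.mul hτ).mul ha).neg_left.congr_right fun τ => by ring
    refine h1.congr' ?_ (EventuallyEq.refl _ _)
    filter_upwards [hden.eventually_ne one_ne_zero] with τ hne
    simp only [hσd, invShift]; field_simp; ring
  set r : ℂ → ℂ := fun τ => sqrtOneAdd (σ τ) with hr
  set δ : ℂ → ℂ := fun τ => rootShift (σ τ) with hδ
  have hr0 : Tendsto r (𝓝 0) (𝓝 1) := by
    have := analyticAt_sqrtOneAdd.continuousAt.tendsto.comp hσ0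
    rwa [sqrtOneAdd_zero] at this
  have hr1 : Tendsto (fun τ => r τ + 1) (𝓝 0) (𝓝 2) := by
    have := hr0.add_const 1
    rwa [one_add_one_eq_two] at this
  have hrinv : Tendsto (fun τ => (r τ + 1)⁻¹) (𝓝 0) (𝓝 2⁻¹) := hr1.inv₀ two_ne_zero
  have hδO : δ =O[𝓝 0] fun τ => τ :=
    (hσ.mul (bdd hrinv)).congr (fun τ => by simp only [hδ, rootShift, hr]; rw [div_eq_mul_inv])
      fun τ => by ring
  have hδ0 : Tendsto δ (𝓝 0) (𝓝 0) := hδO.trans_tendsto hid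
  have hr2 : (fun τ => r τ - 1) =O[𝓝 0] fun τ => τ ^ 2 := by
    have h1 : (fun τ => σ τ * δ τ) =O[𝓝 0] fun τ => τ ^ 2 :=
      (hσ.mul hδO).congr_right fun τ => by ring
    refine h1.congr' ?_ (EventuallyEq.refl _ _)
    have h2 : Tendsto (fun τ => 1 + σ τ ^ 2) (𝓝 0) (𝓝 1) := by
      simpa using tendsto_const_nhds.add (hσ0.pow 2)
    filter_upwards [hr1.eventually_ne two_ne_zero, h2.eventually_ne one_ne_zero] with τ k1 k2
    have := sqrtOneAdd_sq k2
    simp only [hδ, rootShift, hr] at *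
    field_simp
    linear_combination -this
  have hδτ : (fun τ => δ τ - τ / 2) =O[𝓝 0] fun τ => τ ^ 3 := by
    have h1 : (fun τ => (σ τ - τ) * (1 / 2) - (r τ - 1) * σ τ * (r τ + 1)⁻¹ * (1 / 2))
        =O[𝓝 0] fun τ => τ ^ 3 := by
      refine IsBigO.sub ?_ ?_
      · exact (hστ.mul (isBigO_refl (fun _ => (1 / 2 : ℂ)) _)).trans
          (IsBigO.of_bound 1 (Eventually.of_forall fun τ => by
            simp; nlinarith [norm_nonneg τ, pow_nonneg (norm_nonneg τ) 3]))
      · exact (((hr2.mul hσ).mul (bdd hrinv)).mul (bdd tendsto_const_nhds)).congr_right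
          fun τ => by ring
    refine h1.congr' ?_ (EventuallyEq.refl _ _)
    filter_upwards [hr1.eventually_ne two_ne_zero] with τ k1
    simp only [hδ, rootShift, hr] at *
    field_simp; ring
  set a := approxZero
  have hs0 : Tendsto (fun τ => a τ + δ τ) (𝓝 0) (𝓝 0) := by simpa using ha0.add hδ0
  have hsO : (fun τ => a τ + δ τ) =O[𝓝 0] fun τ => τ := ha.add hδO
  have hexp : Tendsto (fun τ => Complex.exp (a τ)) (𝓝 0) (𝓝 1) := by
    have := (Complex.continuous_exp.tendsto 0).comp ha0
    rwa [Complex.exp_zero] at this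
  have hsinh : (fun τ => Complex.sinh (a τ + δ τ)) =O[𝓝 0] fun τ => τ := by
    have h1 := (isBigO_sinh_sub_self.comp_tendsto hs0).trans (hsO.pow 3)
    have h2 : (fun τ : ℂ => τ ^ 3) =O[𝓝 0] fun τ => τ :=
      ((hτ.mul (bdd (hid.pow 2)))).congr (fun τ => by ring) fun τ => by ring
    exact ((h1.trans h2).add hsO).congr_left fun τ => by simp
  have hcosh : Tendsto (fun τ => Complex.cosh (a τ + δ τ)) (𝓝 0) (𝓝 1) := by
    have := (Complex.continuous_cosh.tendsto 0).comp hs0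
    rwa [Complex.cosh_zero] at this
  have t1 : (fun τ => (r τ - 1) * Complex.sinh (a τ + δ τ) * Complex.exp (a τ))
      =O[𝓝 0] fun τ => τ ^ 3 := ((hr2.mul hsinh).mul (bdd hexp)).congr_right fun τ => by ring
  have t2 : (fun τ => (Complex.sinh (a τ + δ τ) - (a τ + δ τ)) * Complex.exp (a τ))
      =O[𝓝 0] fun τ => τ ^ 3 :=
    (((isBigO_sinh_sub_self.comp_tendsto hs0).trans (hsO.pow 3)).mul (bdd hexp)).congr_right
      fun τ => by ring
  have t3 : (fun τ => (a τ + δ τ) * (Complex.exp (a τ) - 1 - a τ)) =O[𝓝 0] fun τ => τ ^ 3 :=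
    (hsO.mul ((isBigO_exp_sub_one_sub_self.comp_tendsto ha0).trans (ha.pow 2))).congr_right
      fun τ => by ring
  have t4 : (fun τ => (δ τ - τ / 2) * (1 + a τ)) =O[𝓝 0] fun τ => τ ^ 3 :=
    (hδτ.mul (bdd (tendsto_const_nhds.add ha0))).congr_right fun τ => by ring
  have t5 : (fun τ : ℂ => τ ^ 3 * (τ / 1024)) =O[𝓝 0] fun τ => τ ^ 3 :=
    ((isBigO_refl (fun τ : ℂ => τ ^ 3) (𝓝 0)).mul
      (bdd (hid.div_const 1024))).congr_right fun τ => by ring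
  have t6 : (fun τ => (Complex.sinh (a τ) - a τ) * Complex.cosh (a τ + δ τ))
      =O[𝓝 0] fun τ => τ ^ 3 :=
    (((isBigO_sinh_sub_self.comp_tendsto ha0).trans (ha.pow 3)).mul (bdd hcosh)).congr_right
      fun τ => by ring
  have t7 : (fun τ => a τ * (Complex.cosh (a τ + δ τ) - 1)) =O[𝓝 0] fun τ => τ ^ 3 :=
    (ha.mul ((isBigO_cosh_sub_one.comp_tendsto hs0).trans (hsO.pow 2))).congr_right
      fun τ => by ring
  refine (((((((t1.add t2).add t3).add t4).add t5).add t6).add t7).neg_left).congr_left fun τ => ?_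
  have c1 : Complex.cosh (Real.pi / 2 * Complex.I) = 0 := by
    rw [Complex.cosh_mul_I, Complex.cos_pi_div_two]
  have c2 : Complex.sinh (Real.pi / 2 * Complex.I) = Complex.I := by
    rw [Complex.sinh_mul_I, Complex.sin_pi_div_two, one_mul]
  have c3 : Complex.exp (Real.pi / 2 * Complex.I) = Complex.I := by
    rw [← Complex.sinh_add_cosh, c1, c2, add_zero]
  rw [charFun, show Real.pi / 2 * Complex.I + a τ + rootShift (invShift (a τ) τ)
      = Real.pi / 2 * Complex.I + (a τ + δ τ) from add_assoc _ _ _,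
    Complex.cosh_add _ (a τ + δ τ), Complex.sinh_add _ (a τ + δ τ),
    Complex.cosh_add _ (a τ), Complex.exp_add, c1, c2, c3]
  have ea : a τ = -τ / 4 + τ ^ 2 / 32 := rfl
  have hI : Complex.I * Complex.I = -1 := Complex.I_mul_I
  change _ = r τ * (0 * _ + Complex.I * Complex.sinh (a τ + δ τ)) * (Complex.I * Complex.exp (a τ))
    + (0 * Complex.cosh (a τ) + Complex.I * Complex.sinh (a τ))
      * (Complex.I * Complex.cosh (a τ + δ τ) + 0 * _)
  generalize Complex.sinh (a τ + δ τ) = S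
  generalize Complex.cosh (a τ + δ τ) = C
  generalize Complex.sinh (a τ) = s
  generalize Complex.exp (a τ) = E
  have ha2 : a τ ^ 2 = (-τ / 4 + τ ^ 2 / 32) ^ 2 := by rw [ea]
  linear_combination (-(r τ * S * E + s * C)) * hI + (2 + τ / 2) * ea + ha2

/-! ### The two branches of eigenvalues -/

theorem tendsto_one_div_add_nat_mul (c : ℂ) :
    Tendsto (fun n : ℕ => 1 / (c + n * (Real.pi * Complex.I))) atTop (𝓝 0) := by
  rw [tendsto_zero_iff_norm_tendsto_zero]
  have h1 : Tendsto (fun n : ℕ => (n : ℝ) * Real.pi - ‖c‖) atTop atTop :=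
    tendsto_atTop_add_const_right _ _
      (tendsto_natCast_atTop_atTop.atTop_mul_const Real.pi_pos)
  refine squeeze_zero' (Eventually.of_forall fun _ => norm_nonneg _) ?_ h1.inv_tendsto_atTop
  filter_upwards [h1.eventually_gt_atTop 0] with n hn
  rw [norm_div, norm_one, one_div]
  refine inv_anti₀ hn ?_
  have : ‖(n : ℂ) * (Real.pi * Complex.I)‖ = n * Real.pi := by
    simp [abs_of_pos Real.pi_pos]
  have h2 := norm_sub_le (c + n * (Real.pi * Complex.I)) c
  rw [add_sub_cancel_left, this] at h2
  linarith

/-- The branch of eigenvalues approaching the imaginary axis, with the expansion to third order. -/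
theorem exists_eigenvalues_imaginary_branch : ∃ β : ℕ → ℂ, (∀ n, IsEigenvalue exGen (β n)) ∧
      (fun n : ℕ => β n
        - (((n : ℂ) + 1 / 2) * (Real.pi : ℂ) * Complex.I
          + Complex.I / (4 * (((n : ℂ) + 1 / 2) * (Real.pi : ℂ)))
          - 1 / (32 * (((n : ℂ) + 1 / 2) * (Real.pi : ℂ)) ^ 2)))
        =O[atTop] (fun n : ℕ => ((n : ℝ) ^ 3)⁻¹) ∧
      (fun n : ℕ => (β n).re) ~[atTop] (fun n : ℕ => -(1 / (32 * (n : ℝ) ^ 2 * Real.pi ^ 2))) := by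
  have hπ : (Real.pi : ℂ) ≠ 0 := Complex.ofReal_ne_zero.2 Real.pi_ne_zero
  have hn : ∀ n : ℕ, (n : ℂ) + 1 / 2 ≠ 0 := fun n => by
    have : ((n : ℂ) + 1 / 2) = ((n + 1 / 2 : ℝ) : ℂ) := by push_cast; ring
    rw [this, Complex.ofReal_ne_zero]; positivity
  set τ : ℕ → ℂ := fun n => 1 / (Real.pi / 2 * Complex.I + n * (Real.pi * Complex.I)) with hτ
  have hfac : ∀ n : ℕ, Real.pi / 2 * Complex.I + n * (Real.pi * Complex.I)
      = ((n : ℂ) + 1 / 2) * Real.pi * Complex.I := fun n => by ring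
  have hne : ∀ n : ℕ, Real.pi / 2 * Complex.I + n * (Real.pi * Complex.I) ≠ (0 : ℂ) := fun n => by
    rw [hfac]; exact mul_ne_zero (mul_ne_zero (hn n) hπ) Complex.I_ne_zero
  have hτt : Tendsto τ atTop (𝓝 0) := tendsto_one_div_add_nat_mul _
  have ha0 : Tendsto approxZero (𝓝 0) (𝓝 0) := by
    have : Continuous approxZero := by unfold approxZero; fun_prop
    simpa [approxZero] using this.tendsto 0
  obtain ⟨β, hβ, -, hO⟩ := exists_eigenvalues_near (y₀ := Real.pi / 2 * Complex.I)
    (τ := τ) (a := fun n => approxZero (τ n))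
    (by rw [Complex.cosh_mul_I, Complex.cos_pi_div_two, zero_mul])
    (by
      rw [show 2 * (Real.pi / 2 * Complex.I) = Real.pi * Complex.I by ring, Complex.exp_pi_mul_I,
        Complex.cosh_mul_I, Complex.cos_pi]
      norm_num)
    hτt (fun n => one_div_ne_zero (hne n)) (fun n => by simp only [hτ, one_div_one_div])
    (ha0.comp hτt)
  have hO2 := hO.trans (charFun_approxZero_isBigO.comp_tendsto hτt)
  have hτO : (fun n => τ n ^ 3) =O[atTop] fun n : ℕ => ((n : ℝ) ^ 3)⁻¹ := by
    refine IsBigO.of_bound 1 ?_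
    filter_upwards [eventually_gt_atTop 0] with n h0
    have h0' : (0 : ℝ) < n := by exact_mod_cast h0
    simp only [hτ]
    rw [hfac, norm_pow, norm_div, norm_one, one_mul, norm_inv, norm_pow, div_pow, one_pow, one_div,
      Real.norm_of_nonneg h0'.le]
    refine inv_anti₀ (by positivity) (pow_le_pow_left₀ h0'.le ?_ 3)
    have : ((n : ℂ) + 1 / 2) = ((n + 1 / 2 : ℝ) : ℂ) := by push_cast; ring
    rw [this, norm_mul, norm_mul, Complex.norm_I, mul_one, Complex.norm_real, Complex.norm_real,
      Real.norm_of_nonneg (by positivity), Real.norm_of_nonneg Real.pi_pos.le]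
    nlinarith [Real.pi_gt_three]
  have hO3 : (fun n : ℕ => β n
        - (((n : ℂ) + 1 / 2) * (Real.pi : ℂ) * Complex.I
          + Complex.I / (4 * (((n : ℂ) + 1 / 2) * (Real.pi : ℂ)))
          - 1 / (32 * (((n : ℂ) + 1 / 2) * (Real.pi : ℂ)) ^ 2)))
        =O[atTop] (fun n : ℕ => ((n : ℝ) ^ 3)⁻¹) := by
    refine (hO2.trans hτO).congr_left fun n => ?_
    have e : 1 / τ n + approxZero (τ n) = ((n : ℂ) + 1 / 2) * (Real.pi : ℂ) * Complex.I
          + Complex.I / (4 * (((n : ℂ) + 1 / 2) * (Real.pi : ℂ)))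
          - 1 / (32 * (((n : ℂ) + 1 / 2) * (Real.pi : ℂ)) ^ 2) := by
      have h2 : τ n = -(Complex.I / (((n : ℂ) + 1 / 2) * Real.pi)) := by
        simp only [hτ]
        rw [hfac, one_div, mul_inv, Complex.inv_I]
        field_simp
      have h3 : 1 / τ n = ((n : ℂ) + 1 / 2) * Real.pi * Complex.I := by
        simp only [hτ, one_div_one_div, hfac]
      rw [h3, approxZero, h2, neg_sq, div_pow, Complex.I_sq]
      have := hn n
      generalize ((n : ℂ) + 1 / 2) = w at *
      field_simp
      ring
    rw [e]
  refine ⟨β, hβ, hO3, ?_⟩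
  -- the difference of the real parts is `O(n⁻³)`
  have hre : (fun n : ℕ => (β n).re + 1 / (32 * (((n : ℝ) + 1 / 2) * Real.pi) ^ 2))
      =O[atTop] fun n : ℕ => ((n : ℝ) ^ 3)⁻¹ := by
    refine IsBigO.trans (IsBigO.of_bound 1 (Eventually.of_forall fun n => ?_)) hO3
    have e : (β n
        - (((n : ℂ) + 1 / 2) * (Real.pi : ℂ) * Complex.I
          + Complex.I / (4 * (((n : ℂ) + 1 / 2) * (Real.pi : ℂ)))
          - 1 / (32 * (((n : ℂ) + 1 / 2) * (Real.pi : ℂ)) ^ 2))).re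
        = (β n).re + 1 / (32 * (((n : ℝ) + 1 / 2) * Real.pi) ^ 2) := by
      have e1 : ((n : ℂ) + 1 / 2) * (Real.pi : ℂ) = (((n + 1 / 2) * Real.pi : ℝ) : ℂ) := by
        push_cast; ring
      have e2 : Complex.I / (4 * (((n + 1 / 2) * Real.pi : ℝ) : ℂ))
          = (((4 * ((n + 1 / 2) * Real.pi))⁻¹ : ℝ) : ℂ) * Complex.I := by
        push_cast; rw [div_eq_mul_inv, mul_comm]
      have e3 : 1 / (32 * (((n + 1 / 2) * Real.pi : ℝ) : ℂ) ^ 2)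
          = ((1 / (32 * (((n : ℝ) + 1 / 2) * Real.pi) ^ 2) : ℝ) : ℂ) := by
        push_cast; rfl
      rw [e1, e2, e3, Complex.sub_re, Complex.sub_re, Complex.add_re, Complex.re_ofReal_mul,
        Complex.re_ofReal_mul, Complex.I_re, Complex.ofReal_re]
      ring
    rw [one_mul, ← e, Real.norm_eq_abs]
    exact Complex.abs_re_le_norm _
  have hdiff : (fun n : ℕ => 1 / (32 * (n : ℝ) ^ 2 * Real.pi ^ 2)
      - 1 / (32 * (((n : ℝ) + 1 / 2) * Real.pi) ^ 2)) =O[atTop] fun n : ℕ => ((n : ℝ) ^ 3)⁻¹ := by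
    refine IsBigO.of_bound 1 ?_
    filter_upwards [eventually_gt_atTop 0] with n h0
    have h0' : (0 : ℝ) < n := by exact_mod_cast h0
    have hpi := Real.pi_pos
    have e : 1 / (32 * (n : ℝ) ^ 2 * Real.pi ^ 2) - 1 / (32 * (((n : ℝ) + 1 / 2) * Real.pi) ^ 2)
        = (n + 1 / 4) / (32 * Real.pi ^ 2 * n ^ 2 * (n + 1 / 2) ^ 2) := by
      field_simp; ring
    have hle : (n + 1 / 4) / (32 * Real.pi ^ 2 * n ^ 2 * (n + 1 / 2) ^ 2) ≤ ((n : ℝ) ^ 3)⁻¹ := by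
      rw [div_le_iff₀ (by positivity)]
      have : ((n : ℝ) ^ 3)⁻¹ * (32 * Real.pi ^ 2 * n ^ 2 * (n + 1 / 2) ^ 2)
          = 32 * Real.pi ^ 2 * ((n + 1 / 2) ^ 2 / n) := by field_simp
      rw [this]
      have h1 : (n : ℝ) + 1 / 4 ≤ (n + 1 / 2) ^ 2 / n := by
        rw [le_div_iff₀ h0']; nlinarith
      have h2 : 1 ≤ 32 * Real.pi ^ 2 := by nlinarith [Real.pi_gt_three]
      calc (n : ℝ) + 1 / 4 ≤ (n + 1 / 2) ^ 2 / n := h1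
        _ ≤ _ := le_mul_of_one_le_left (by positivity) h2
    rw [e, one_mul, Real.norm_of_nonneg (by positivity), Real.norm_of_nonneg (by positivity)]
    exact hle
  have hsum : (fun n : ℕ => (β n).re - -(1 / (32 * (n : ℝ) ^ 2 * Real.pi ^ 2)))
      =O[atTop] fun n : ℕ => ((n : ℝ) ^ 3)⁻¹ :=
    (hre.add hdiff).congr_left fun n => by ring
  refine hsum.trans_isLittleO ?_
  have hlim : Tendsto (fun n : ℕ => 32 * Real.pi ^ 2 * ((n : ℝ))⁻¹) atTop (𝓝 0) := by
    have : Tendsto (fun n : ℕ => 32 * Real.pi ^ 2 * ((n : ℝ))⁻¹) atTop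
        (𝓝 (32 * Real.pi ^ 2 * 0)) :=
      (tendsto_inv_atTop_zero.comp tendsto_natCast_atTop_atTop).const_mul _
    rwa [mul_zero] at this
  refine IsLittleO.of_bound fun c hc => ?_
  filter_upwards [hlim.eventually_lt_const hc, eventually_gt_atTop 0] with n h1 h0
  have h0' : (0 : ℝ) < n := by exact_mod_cast h0
  have hpi := Real.pi_pos
  rw [norm_neg, Real.norm_of_nonneg (by positivity), Real.norm_of_nonneg (by positivity)]
  have : ((n : ℝ) ^ 3)⁻¹ = (32 * Real.pi ^ 2 * ((n : ℝ))⁻¹) * (1 / (32 * n ^ 2 * Real.pi ^ 2)) := by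
    field_simp
  rw [this]
  exact mul_le_mul_of_nonneg_right h1.le (by positivity)

/-- The branch of eigenvalues approaching the line `Re β = -(ln 3)/2`. -/
theorem exists_eigenvalues_damped_branch : ∃ γ : ℕ → ℂ, (∀ n, IsEigenvalue exGen (γ n)) ∧
      Tendsto (fun n : ℕ => γ n - (n : ℂ) * (Real.pi : ℂ) * Complex.I) atTop
        (𝓝 (-((Real.log 3 / 2 : ℝ) : ℂ))) := by
  set y₀ : ℂ := -((Real.log 3 / 2 : ℝ) : ℂ) with hy
  have hexp : Complex.exp (2 * y₀) = 1 / 3 := by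
    have : 2 * y₀ = ((-Real.log 3 : ℝ) : ℂ) := by rw [hy]; push_cast; ring
    rw [this, ← Complex.ofReal_exp, Real.exp_neg, Real.exp_log (by norm_num)]
    norm_num
  have hexp2 : Complex.exp (-(2 * y₀)) = 3 := by rw [Complex.exp_neg, hexp]; norm_num
  have hne : ∀ n : ℕ, y₀ + n * (Real.pi * Complex.I) ≠ 0 := fun n h => by
    have h1 := congrArg Complex.re h
    have h2 : (0 : ℝ) < Real.log 3 := Real.log_pos (by norm_num)
    rw [← mul_assoc, show (n : ℂ) * Real.pi = ((n * Real.pi : ℝ) : ℂ) by push_cast; rfl,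
      Complex.add_re, Complex.re_ofReal_mul, Complex.I_re, hy, Complex.neg_re,
      Complex.ofReal_re, Complex.zero_re] at h1
    linarith
  obtain ⟨γ, hγ, ht, -⟩ := exists_eigenvalues_near (y₀ := y₀)
    (τ := fun n : ℕ => 1 / (y₀ + n * (Real.pi * Complex.I))) (a := fun _ => 0)
    (by
      have h1 : Complex.exp y₀ * Complex.exp y₀ = 1 / 3 := by
        rw [← Complex.exp_add, ← two_mul, hexp]
      have h2 : Complex.exp y₀ * Complex.exp (-y₀) = 1 := by rw [← Complex.exp_add]; simp
      have h3 : Complex.exp y₀ * (Complex.exp y₀ + Complex.sinh y₀) = 0 := by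
        rw [Complex.sinh]; linear_combination (3 / 2) * h1 - (1 / 2) * h2
      rw [(mul_eq_zero.1 h3).resolve_left (Complex.exp_ne_zero _), mul_zero])
    (by rw [Complex.cosh, hexp, hexp2]; norm_num)
    (tendsto_one_div_add_nat_mul _) (fun n => one_div_ne_zero (hne n))
    (fun n => one_div_one_div _) tendsto_const_nhds
  refine ⟨γ, hγ, ?_⟩
  have := ht.add_const y₀
  rw [zero_add] at this
  refine this.congr fun n => ?_
  rw [one_div_one_div]; ring

/-! ### Optimality of the decay rate -/

/-- An eigenvector `z` with eigenvalue `b` generates the classical solution `e^{bt} z`. -/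
theorem isClassicalSolution_exp_smul {E : Type*} [NormedAddCommGroup E] [NormedSpace ℂ E]
    {T : E →ₗ.[ℂ] E} {b : ℂ} {z : T.domain} (hz : T z = b • (z : E)) :
    IsClassicalSolution T z fun t => Complex.exp (b * t) • (z : E) := by
  have hd : ∀ t : ℝ, HasDerivAt (fun t : ℝ => Complex.exp (b * t)) (Complex.exp (b * t) * b) t := by
    intro t
    have : HasDerivAt (fun t : ℝ => b * (t : ℂ)) b t := by
      simpa using (Complex.ofRealCLM.hasDerivAt (x := t)).const_mul b
    exact this.cexp
  have hc : ContDiff ℝ 1 fun t : ℝ => Complex.exp (b * t) :=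
    Complex.contDiff_exp.comp (contDiff_const.mul Complex.ofRealCLM.contDiff)
  refine ⟨by simp, (hc.smul contDiff_const).contDiffOn, fun t _ =>
    ⟨T.domain.smul_mem _ z.2, ?_⟩⟩
  have e : T ⟨Complex.exp (b * t) • (z : E), T.domain.smul_mem _ z.2⟩
      = (Complex.exp (b * t) * b) • (z : E) := by
    have := T.map_smul (Complex.exp (b * t)) z
    rw [hz, smul_smul] at this
    exact this
  rw [e]
  exact ((hd t).smul_const (z : E)).hasDerivWithinAt

/-- The rate `t^{-1/2}` is attained by the eigenvectors for `β_n` with `n ≈ √t`, as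
`|Re β_n| ≲ n⁻²` and `|β_n| ≲ n`. -/
theorem exists_slow_solutions : ∃ c : ℝ, 0 < c ∧ ∀ t : ℝ, 1 ≤ t →
      ∃ (z : exGen.domain) (Z : ℝ → State 2), (z : State 2) ≠ 0 ∧
        IsClassicalSolution exGen z Z ∧
        c / t ^ (1 / 2 : ℝ) * graphNorm exGen z ≤ ‖Z t‖ := by
  obtain ⟨β, hβ, hO, hre⟩ := exists_eigenvalues_imaginary_branch
  have h1 : (fun n => (β n).re) =O[atTop] fun n : ℕ => ((n : ℝ) ^ 2)⁻¹ := by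
    refine hre.isBigO.trans (IsBigO.of_bound 1 (Eventually.of_forall fun n => ?_))
    rw [norm_neg, Real.norm_of_nonneg (by positivity), Real.norm_of_nonneg (by positivity), one_mul,
      one_div, mul_right_comm, mul_inv]
    refine mul_le_of_le_one_left (by positivity) (inv_le_one_of_one_le₀ ?_)
    nlinarith [Real.pi_gt_three]
  have h2 : (fun n => β n) =O[atTop] fun n : ℕ => (n : ℝ) := by
    have hsm : (fun n : ℕ => ((n : ℝ) ^ 3)⁻¹) =O[atTop] fun n : ℕ => (n : ℝ) := by
      refine IsBigO.of_bound 1 ?_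
      filter_upwards [eventually_ge_atTop 1] with n hn
      have hn' : (1 : ℝ) ≤ n := by exact_mod_cast hn
      rw [one_mul, Real.norm_of_nonneg (by positivity), Real.norm_of_nonneg (by positivity)]
      exact (inv_le_one_of_one_le₀ (one_le_pow₀ hn')).trans hn'
    have hmain : (fun n : ℕ => (((n : ℂ) + 1 / 2) * (Real.pi : ℂ) * Complex.I
          + Complex.I / (4 * (((n : ℂ) + 1 / 2) * (Real.pi : ℂ)))
          - 1 / (32 * (((n : ℂ) + 1 / 2) * (Real.pi : ℂ)) ^ 2))) =O[atTop]
          fun n : ℕ => (n : ℝ) := by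
      refine IsBigO.of_bound 10 ?_
      filter_upwards [eventually_ge_atTop 1] with n hn
      have hn' : (1 : ℝ) ≤ n := by exact_mod_cast hn
      have e1 : ((n : ℂ) + 1 / 2) * (Real.pi : ℂ) = (((n + 1 / 2) * Real.pi : ℝ) : ℂ) := by
        push_cast; ring
      set w : ℝ := (n + 1 / 2) * Real.pi with hw
      have hw1 : 1 ≤ w := by nlinarith [Real.pi_gt_three]
      have hw2 : w ≤ 8 * n := by nlinarith [Real.pi_lt_four]
      have hwn : ‖(w : ℂ)‖ = w := by rw [Complex.norm_real, Real.norm_of_nonneg (by linarith)]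
      rw [e1, Real.norm_of_nonneg (by positivity)]
      have a1 : ‖(w : ℂ) * Complex.I‖ = w := by rw [norm_mul, Complex.norm_I, mul_one, hwn]
      have a2 : ‖Complex.I / (4 * (w : ℂ))‖ ≤ 1 := by
        rw [norm_div, Complex.norm_I, norm_mul, hwn, div_le_one (by simp; linarith)]
        simp; linarith
      have a3 : ‖1 / (32 * (w : ℂ) ^ 2)‖ ≤ 1 := by
        rw [norm_div, norm_one, norm_mul, norm_pow, hwn, div_le_one (by simp; positivity)]
        simp; nlinarith
      calc _ ≤ ‖(w : ℂ) * Complex.I + Complex.I / (4 * (w : ℂ))‖ + ‖1 / (32 * (w : ℂ) ^ 2)‖ :=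
            norm_sub_le _ _
        _ ≤ w + 1 + 1 := by
            refine add_le_add ((norm_add_le _ _).trans ?_) a3
            rw [a1]; linarith
        _ ≤ 10 * n := by linarith
    exact ((hO.trans hsm).add hmain).congr_left fun n => by ring
  obtain ⟨C₁, hC₁, b1⟩ := h1.exists_pos
  obtain ⟨C₂, hC₂, b2⟩ := h2.exists_pos
  obtain ⟨N, hN⟩ := eventually_atTop.1 (b1.bound.and b2.bound)
  refine ⟨Real.exp (-C₁) / (1 + C₂ * (N + 2)), by positivity, fun t ht => ?_⟩
  set n : ℕ := N + ⌈Real.sqrt t⌉₊ with hn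
  have hs1 : 1 ≤ Real.sqrt t := Real.one_le_sqrt.2 ht
  have hn1 : Real.sqrt t ≤ n := by
    have := Nat.le_ceil (Real.sqrt t)
    have hN0 : (0 : ℝ) ≤ N := by positivity
    rw [hn]; push_cast; linarith
  have hn2 : (n : ℝ) ≤ (N + 2) * Real.sqrt t := by
    have := Nat.ceil_lt_add_one (Real.sqrt_nonneg t)
    have hN0 : (0 : ℝ) ≤ N := by positivity
    rw [hn]; push_cast; nlinarith
  obtain ⟨k1, k2⟩ := hN n (Nat.le_add_right _ _)
  have hn0 : (0 : ℝ) < n := by linarith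
  rw [Real.norm_eq_abs, Real.norm_of_nonneg (by positivity)] at k1
  rw [Real.norm_of_nonneg hn0.le] at k2
  obtain ⟨z, hz0, hz⟩ := hβ n
  refine ⟨z, _, hz0, isClassicalSolution_exp_smul hz, ?_⟩
  have hsq : t ^ (1 / 2 : ℝ) = Real.sqrt t := (Real.sqrt_eq_rpow t).symm
  have hzn : 0 ≤ ‖(z : State 2)‖ := norm_nonneg _
  have hexp : Real.exp (-C₁) ≤ ‖Complex.exp (β n * t)‖ := by
    rw [Complex.norm_exp]
    refine Real.exp_le_exp.2 ?_
    have e : (β n * t).re = (β n).re * t := by simp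
    rw [e]
    have h3 : t ≤ (n : ℝ) ^ 2 := by
      calc t = Real.sqrt t ^ 2 := (Real.sq_sqrt (by linarith)).symm
        _ ≤ _ := pow_le_pow_left₀ (by linarith) hn1 2
    have h4 : |(β n).re| * t ≤ C₁ := by
      calc |(β n).re| * t ≤ C₁ * ((n : ℝ) ^ 2)⁻¹ * (n : ℝ) ^ 2 :=
            mul_le_mul k1 h3 (by linarith) (by positivity)
        _ = C₁ := by field_simp
    have h5 := neg_abs_le ((β n).re)
    nlinarith
  have hg : graphNorm exGen z = (1 + ‖β n‖) * ‖(z : State 2)‖ := by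
    rw [graphNorm, hz, norm_smul]; ring
  have hb : 1 + ‖β n‖ ≤ (1 + C₂ * (N + 2)) * Real.sqrt t := by
    have : C₂ * n ≤ C₂ * ((N + 2) * Real.sqrt t) := mul_le_mul_of_nonneg_left hn2 hC₂.le
    nlinarith
  rw [hsq, hg, norm_smul, ← mul_assoc]
  refine mul_le_mul_of_nonneg_right (le_trans ?_ hexp) hzn
  calc Real.exp (-C₁) / (1 + C₂ * (N + 2)) / Real.sqrt t * (1 + ‖β n‖)
      ≤ Real.exp (-C₁) / (1 + C₂ * (N + 2)) / Real.sqrt t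
        * ((1 + C₂ * (N + 2)) * Real.sqrt t) := mul_le_mul_of_nonneg_left hb (by positivity)
    _ = Real.exp (-C₁) := by field_simp

/-! ### Quadratic functionals along solutions -/

/-- The real part of the sesquilinear form `⟪S z, T z⟫`. -/
def quad {E F : Type*} [NormedAddCommGroup E] [NormedSpace ℂ E] [NormedAddCommGroup F]
    [InnerProductSpace ℂ F] (S T : E →L[ℂ] F) (z : E) : ℝ := (⟪S z, T z⟫_ℂ).re

/-- The derivative of `quad S T` at `z` in the direction `y`. -/
def quadDer {E F : Type*} [NormedAddCommGroup E] [NormedSpace ℂ E] [NormedAddCommGroup F]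
    [InnerProductSpace ℂ F] (S T : E →L[ℂ] F) (z y : E) : ℝ :=
  (⟪S z, T y⟫_ℂ).re + (⟪S y, T z⟫_ℂ).re

section quad

variable {E F : Type*} [NormedAddCommGroup E] [NormedSpace ℂ E] [NormedAddCommGroup F]
    [InnerProductSpace ℂ F]

theorem hasDerivWithinAt_quad (S T : E →L[ℂ] F) {Z : ℝ → E} {y : E} {s : Set ℝ} {t : ℝ}
    (h : HasDerivWithinAt Z y s t) :
    HasDerivWithinAt (fun t => quad S T (Z t)) (quadDer S T (Z t) y) s t := by
  have hS : HasDerivWithinAt (fun t => S (Z t)) (S y) s t :=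
    (S.restrictScalars ℝ).hasFDerivAt.comp_hasDerivWithinAt t h
  have hT : HasDerivWithinAt (fun t => T (Z t)) (T y) s t :=
    (T.restrictScalars ℝ).hasFDerivAt.comp_hasDerivWithinAt t h
  have h1 := hS.inner ℂ hT
  have h2 : HasDerivWithinAt (fun t => (⟪S (Z t), T (Z t)⟫_ℂ).re)
      (⟪S (Z t), T y⟫_ℂ + ⟪S y, T (Z t)⟫_ℂ).re s t :=
    Complex.reCLM.hasFDerivAt.comp_hasDerivWithinAt t h1
  rwa [Complex.add_re] at h2

theorem abs_quad_le (S T : E →L[ℂ] F) (z : E) : |quad S T z| ≤ ‖S‖ * ‖T‖ * ‖z‖ ^ 2 := by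
  calc |quad S T z| ≤ ‖S z‖ * ‖T z‖ :=
        (Complex.abs_re_le_norm _).trans (norm_inner_le_norm _ _)
    _ ≤ (‖S‖ * ‖z‖) * (‖T‖ * ‖z‖) := by
        gcongr
        · exact S.le_opNorm z
        · exact T.le_opNorm z
    _ = _ := by ring

theorem continuous_quad (S T : E →L[ℂ] F) : Continuous (quad S T) :=
  Complex.continuous_re.comp (S.continuous.inner T.continuous)

theorem quad_self (S : E →L[ℂ] F) (z : E) : quad S S z = ‖S z‖ ^ 2 :=
  inner_self_eq_norm_sq (𝕜 := ℂ) (S z)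

end quad

/-! ### The components of a state -/

theorem State_norm_sq (z : State 2) : ‖z‖ ^ 2
    = ‖z.fst 0‖ ^ 2 + ‖z.fst 1‖ ^ 2 + (‖z.snd 0‖ ^ 2 + ‖z.snd 1‖ ^ 2) := by
  rw [WithLp.prod_norm_sq_eq_of_L2, PiLp.norm_sq_eq_of_L2, PiLp.norm_sq_eq_of_L2,
    Fin.sum_univ_two, Fin.sum_univ_two]

theorem norm_fst_apply_le (z : State 2) (i : Fin 2) : ‖z.fst i‖ ≤ ‖z‖ := by
  refine le_of_sq_le_sq ?_ (norm_nonneg _)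
  rw [State_norm_sq]
  fin_cases i <;> simp only [Fin.zero_eta, Fin.mk_one] <;> nlinarith [sq_nonneg ‖z.fst 0‖,
    sq_nonneg ‖z.fst 1‖, sq_nonneg ‖z.snd 0‖, sq_nonneg ‖z.snd 1‖]

theorem norm_snd_apply_le (z : State 2) (i : Fin 2) : ‖z.snd i‖ ≤ ‖z‖ := by
  refine le_of_sq_le_sq ?_ (norm_nonneg _)
  rw [State_norm_sq]
  fin_cases i <;> simp only [Fin.zero_eta, Fin.mk_one] <;> nlinarith [sq_nonneg ‖z.fst 0‖,
    sq_nonneg ‖z.fst 1‖, sq_nonneg ‖z.snd 0‖, sq_nonneg ‖z.snd 1‖]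

/-- The space derivative of the `i`-th displacement, as a bounded operator on the states. -/
def dispDer (i : Fin 2) : State 2 →L[ℂ] L2 :=
  LinearMap.mkContinuous
    { toFun := fun z => der (z.fst i)
      map_add' := fun z y => by simp
      map_smul' := fun c z => by simp } 1
    (fun z => by rw [one_mul]; exact (norm_der_le _).trans (norm_fst_apply_le z i))

/-- The `i`-th displacement, as a bounded operator from the states to `L²(0,1)`. -/
def disp (i : Fin 2) : State 2 →L[ℂ] L2 :=
  LinearMap.mkContinuous
    { toFun := fun z => toL2 (z.fst i)
      map_add' := fun z y => by simp
      map_smul' := fun c z => by simp } 1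
    (fun z => by rw [one_mul]; exact (norm_toL2_le _).trans (norm_fst_apply_le z i))

/-- The `i`-th velocity, as a bounded operator on the states. -/
def vel (i : Fin 2) : State 2 →L[ℂ] L2 :=
  LinearMap.mkContinuous
    { toFun := fun z => z.snd i
      map_add' := fun z y => by simp
      map_smul' := fun c z => by simp } 1
    (fun z => by rw [one_mul]; exact norm_snd_apply_le z i)

/-- The boundary value of the `i`-th displacement, as a bounded functional on the states. -/
def bdry (i : Fin 2) : State 2 →L[ℂ] ℂ :=
  LinearMap.mkContinuous
    { toFun := fun z => trace (z.fst i)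
      map_add' := fun z y => by simp
      map_smul' := fun c z => by simp } 1
    (fun z => by
      rw [one_mul]
      exact (norm_trace_le _).trans ((norm_der_le _).trans (norm_fst_apply_le z i)))

theorem dispDer_apply (i : Fin 2) (z : State 2) : dispDer i z = der (z.fst i) := rfl
theorem disp_apply (i : Fin 2) (z : State 2) : disp i z = toL2 (z.fst i) := rfl
theorem vel_apply (i : Fin 2) (z : State 2) : vel i z = z.snd i := rfl
theorem bdry_apply (i : Fin 2) (z : State 2) : bdry i z = trace (z.fst i) := rfl

/-- The energy `‖u_x‖² + ‖v_x‖² + ‖u‖² + ‖u'‖² + ‖v'‖²` of a state. -/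
def energy (z : State 2) : ℝ :=
  quad (dispDer 0) (dispDer 0) z + quad (dispDer 1) (dispDer 1) z + quad (disp 0) (disp 0) z
    + quad (vel 0) (vel 0) z + quad (vel 1) (vel 1) z

/-- The derivative of the energy at `z` in the direction `y`. -/
def energyDer (z y : State 2) : ℝ :=
  quadDer (dispDer 0) (dispDer 0) z y + quadDer (dispDer 1) (dispDer 1) z y
    + quadDer (disp 0) (disp 0) z y + quadDer (vel 0) (vel 0) z y + quadDer (vel 1) (vel 1) z y

theorem energy_eq (z : State 2) : energy z = ‖der (z.fst 0)‖ ^ 2 + ‖der (z.fst 1)‖ ^ 2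
    + ‖toL2 (z.fst 0)‖ ^ 2 + ‖z.snd 0‖ ^ 2 + ‖z.snd 1‖ ^ 2 := by
  simp only [energy, quad_self]; rfl

theorem norm_sq_le_energy (z : State 2) : ‖z‖ ^ 2 ≤ 2 * energy z := by
  rw [State_norm_sq, H1_norm_sq, H1_norm_sq, energy_eq]
  have h := pow_le_pow_left₀ (norm_nonneg _) (norm_toL2_le_norm_der (z.fst 1)) 2
  nlinarith [sq_nonneg ‖z.snd 0‖, sq_nonneg ‖z.snd 1‖, sq_nonneg ‖der (z.fst 0)‖,
    sq_nonneg ‖toL2 (z.fst 0)‖]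

theorem energy_le_norm_sq (z : State 2) : energy z ≤ ‖z‖ ^ 2 := by
  rw [State_norm_sq, H1_norm_sq, H1_norm_sq, energy_eq]
  nlinarith [sq_nonneg ‖toL2 (z.fst 1)‖]

/-! ### Multiplier identities -/

/-! In the names below `u`, `v` are the two displacements, `w = u - v`, and `d = u'(1) - v'(1)` is the
damped quantity, so that `u_x(1) = -d`, `v_x(1) = d` and `w'' - w_xx = -u`. -/

theorem inner_mulX_comm (f g : L2) : (⟪mulX f, g⟫_ℂ).re = (⟪mulX g, f⟫_ℂ).re := by
  have : ⟪mulX f, g⟫_ℂ = ⟪f, mulX g⟫_ℂ := by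
    rw [L2.inner_def, L2.inner_def]
    refine integral_congr_ae ?_
    filter_upwards [mulX_ae f, mulX_ae g] with x h1 h2
    rw [h1, h2]
    simp only [RCLike.inner_apply, map_mul, Complex.conj_ofReal]
    ring
  rw [this]
  exact inner_re_symm (𝕜 := ℂ) _ _

/-- The multiplier `x f_x` for a solution `f` with velocity `p` and `f_xx = h`, `f_x(1) = -κ`. -/
theorem multiplier_identity {f p : H1} {h : L2} {κ : ℂ}
    (H : ∀ φ : H1, ⟪der φ, der f⟫_ℂ + ⟪toL2 φ, h⟫_ℂ + κ * (starRingEnd ℂ) (trace φ) = 0) :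
    2 * (⟪mulX (der f), h⟫_ℂ).re + 2 * (⟪mulX (der p), toL2 p⟫_ℂ).re
      = ‖κ‖ ^ 2 - ‖der f‖ ^ 2 + (‖trace p‖ ^ 2 - ‖toL2 p‖ ^ 2) := by
  have h1 := two_re_inner_mulX (ae_eq_of_weak H)
  rw [sub_add_cancel, norm_neg] at h1
  have h2 := two_re_inner_mulX (f := toL2 p) (h := der p) (c := 0) (by
    filter_upwards [toL2_ae p] with x hx
    rw [hx, zero_add])
  rw [zero_add, inner_mulX_comm] at h2
  change _ = ‖trace p‖ ^ 2 - _ at h2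
  linarith

section identities

variable {z y : State 2}

/-- The damped boundary quantity `d = u'(1) - v'(1)`, in terms of the time derivative `y`. -/
def damp (y : State 2) : ℂ := trace (y.fst 0) - trace (y.fst 1)

theorem weak_u (h : (z, y) ∈ genGraph matA matD) (φ : H1) :
    ⟪der φ, der (z.fst 0)⟫_ℂ + ⟪toL2 φ, y.snd 0 + toL2 (z.fst 0)⟫_ℂ
      + damp y * (starRingEnd ℂ) (trace φ) = 0 :=
  (mem_genGraph_iff.1 h).2.1 φ

theorem weak_v (h : (z, y) ∈ genGraph matA matD) (φ : H1) :
    ⟪der φ, der (z.fst 1)⟫_ℂ + ⟪toL2 φ, y.snd 1⟫_ℂ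
      + -damp y * (starRingEnd ℂ) (trace φ) = 0 := by
  have := (mem_genGraph_iff.1 h).2.2 φ
  rw [damp]; linear_combination this

theorem weak_w (h : (z, y) ∈ genGraph matA matD) (φ : H1) :
    ⟪der φ, der (z.fst 0 - z.fst 1)⟫_ℂ
      + ⟪toL2 φ, (y.snd 0 - y.snd 1) + toL2 (z.fst 0)⟫_ℂ
      + 2 * damp y * (starRingEnd ℂ) (trace φ) = 0 := by
  have h1 := weak_u h φ
  have h2 := weak_v h φ
  rw [map_sub, inner_sub_right, inner_add_right, inner_sub_right]
  rw [inner_add_right] at h1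
  linear_combination h1 - h2

theorem energyDer_eq (h : (z, y) ∈ genGraph matA matD) :
    energyDer z y = -2 * ‖damp y‖ ^ 2 := by
  have h1 := congrArg Complex.re (weak_u h (y.fst 0))
  have h2 := congrArg Complex.re (weak_v h (y.fst 1))
  obtain ⟨e1, e2⟩ := (mem_genGraph_iff.1 h).1
  have hd : (damp y * (starRingEnd ℂ) (trace (y.fst 0))).re
      - (damp y * (starRingEnd ℂ) (trace (y.fst 1))).re = ‖damp y‖ ^ 2 := by
    rw [← Complex.sub_re, ← mul_sub, ← map_sub]
    change (damp y * (starRingEnd ℂ) (damp y)).re = _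
    rw [Complex.mul_conj, Complex.normSq_eq_norm_sq, Complex.ofReal_re]
  rw [← e1] at h1
  rw [← e2] at h2
  simp only [inner_add_right, Complex.add_re, Complex.zero_re, neg_mul, Complex.neg_re] at h1 h2
  simp only [energyDer, quadDer, dispDer_apply, disp_apply, vel_apply, ← e1]
  have s1 : (⟪der (z.fst 0), der (y.fst 0)⟫_ℂ).re = (⟪der (y.fst 0), der (z.fst 0)⟫_ℂ).re :=
    inner_re_symm (𝕜 := ℂ) _ _
  have s2 : (⟪der (z.fst 1), der (y.fst 1)⟫_ℂ).re = (⟪der (y.fst 1), der (z.fst 1)⟫_ℂ).re :=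
    inner_re_symm (𝕜 := ℂ) _ _
  have s3 : (⟪toL2 (z.fst 0), z.snd 0⟫_ℂ).re = (⟪z.snd 0, toL2 (z.fst 0)⟫_ℂ).re :=
    inner_re_symm (𝕜 := ℂ) _ _
  have s4 : (⟪y.snd 0, z.snd 0⟫_ℂ).re = (⟪z.snd 0, y.snd 0⟫_ℂ).re :=
    inner_re_symm (𝕜 := ℂ) _ _
  have s5 : (⟪y.snd 1, z.snd 1⟫_ℂ).re = (⟪z.snd 1, y.snd 1⟫_ℂ).re :=
    inner_re_symm (𝕜 := ℂ) _ _
  linarith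

/-- The multiplier `x w_x`. -/
theorem multiplier_x_w (h : (z, y) ∈ genGraph matA matD) :
    2 * quadDer (mulX ∘L (dispDer 0 - dispDer 1)) (vel 0 - vel 1) z y
      = 4 * ‖damp y‖ ^ 2 - ‖der (z.fst 0 - z.fst 1)‖ ^ 2
        + (‖damp y‖ ^ 2 - ‖z.snd 0 - z.snd 1‖ ^ 2)
        - 2 * (⟪mulX (der (z.fst 0 - z.fst 1)), toL2 (z.fst 0)⟫_ℂ).re := by
  obtain ⟨e1, e2⟩ := (mem_genGraph_iff.1 h).1
  have h1 := multiplier_identity (p := y.fst 0 - y.fst 1) (weak_w h)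
  rw [inner_add_right, Complex.add_re, norm_mul, Complex.norm_ofNat, mul_pow] at h1
  have e3 : toL2 (y.fst 0 - y.fst 1) = z.snd 0 - z.snd 1 := by rw [map_sub, e1, e2]
  have e4 : trace (y.fst 0 - y.fst 1) = damp y := by rw [map_sub, damp]
  rw [e3, e4] at h1
  simp only [quadDer, ContinuousLinearMap.comp_apply, sub_apply, dispDer_apply, vel_apply,
    ← map_sub der]
  linarith

/-- The multiplier `w`. -/
theorem multiplier_w (h : (z, y) ∈ genGraph matA matD) :
    quadDer (disp 0 - disp 1) (vel 0 - vel 1) z y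
      = ‖z.snd 0 - z.snd 1‖ ^ 2 - ‖der (z.fst 0 - z.fst 1)‖ ^ 2
        - 2 * (damp y * (starRingEnd ℂ) (trace (z.fst 0 - z.fst 1))).re
        - (⟪toL2 (z.fst 0 - z.fst 1), toL2 (z.fst 0)⟫_ℂ).re := by
  obtain ⟨e1, e2⟩ := (mem_genGraph_iff.1 h).1
  have h1 := congrArg Complex.re (weak_w h (z.fst 0 - z.fst 1))
  have s1 : (⟪der (z.fst 0 - z.fst 1), der (z.fst 0 - z.fst 1)⟫_ℂ).re
      = ‖der (z.fst 0 - z.fst 1)‖ ^ 2 := inner_self_eq_norm_sq (𝕜 := ℂ) _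
  have s2 : (⟪z.snd 0 - z.snd 1, z.snd 0 - z.snd 1⟫_ℂ).re
      = ‖z.snd 0 - z.snd 1‖ ^ 2 := inner_self_eq_norm_sq (𝕜 := ℂ) _
  rw [inner_add_right (𝕜 := ℂ) (toL2 (z.fst 0 - z.fst 1)) (y.snd 0 - y.snd 1) (toL2 (z.fst 0))] at h1
  have s3 : (2 * damp y * (starRingEnd ℂ) (trace (z.fst 0 - z.fst 1))).re
      = 2 * (damp y * (starRingEnd ℂ) (trace (z.fst 0 - z.fst 1))).re := by
    rw [mul_assoc, ← Complex.ofReal_ofNat, Complex.re_ofReal_mul]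
  simp only [Complex.add_re, Complex.zero_re, s1, s3] at h1
  simp only [quadDer, sub_apply, disp_apply, vel_apply, ← map_sub toL2]
  rw [show toL2 (y.fst 0 - y.fst 1) = z.snd 0 - z.snd 1 by rw [map_sub, e1, e2], s2]
  linarith

/-- Pairing the equation of `w` with `u` and that of `u` with `w`: this is where the coupling
enters, through the term `‖u‖²`. -/
theorem multiplier_cross (h : (z, y) ∈ genGraph matA matD) :
    quadDer (disp 0) (vel 0 - vel 1) z y - quadDer (vel 0) (disp 0 - disp 1) z y
      = -‖toL2 (z.fst 0)‖ ^ 2 + (⟪toL2 (z.fst 0 - z.fst 1), toL2 (z.fst 0)⟫_ℂ).re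
        - 2 * (damp y * (starRingEnd ℂ) (trace (z.fst 0))).re
        + (damp y * (starRingEnd ℂ) (trace (z.fst 0 - z.fst 1))).re := by
  obtain ⟨e1, e2⟩ := (mem_genGraph_iff.1 h).1
  have h1 := congrArg Complex.re (weak_w h (z.fst 0))
  have h2 := congrArg Complex.re (weak_u h (z.fst 0 - z.fst 1))
  have s1 : (⟪toL2 (z.fst 0), toL2 (z.fst 0)⟫_ℂ).re
      = ‖toL2 (z.fst 0)‖ ^ 2 := inner_self_eq_norm_sq (𝕜 := ℂ) _
  rw [inner_add_right] at h1 h2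
  have s3 : (2 * damp y * (starRingEnd ℂ) (trace (z.fst 0))).re
      = 2 * (damp y * (starRingEnd ℂ) (trace (z.fst 0))).re := by
    rw [mul_assoc, ← Complex.ofReal_ofNat, Complex.re_ofReal_mul]
  simp only [Complex.add_re, Complex.zero_re, s1, s3] at h1 h2
  have s4 : (⟪der (z.fst 0 - z.fst 1), der (z.fst 0)⟫_ℂ).re
      = (⟪der (z.fst 0), der (z.fst 0 - z.fst 1)⟫_ℂ).re := inner_re_symm (𝕜 := ℂ) _ _
  have s5 : (⟪toL2 (z.fst 0 - z.fst 1), y.snd 0⟫_ℂ).re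
      = (⟪y.snd 0, toL2 (z.fst 0 - z.fst 1)⟫_ℂ).re := inner_re_symm (𝕜 := ℂ) _ _
  simp only [quadDer, sub_apply, disp_apply, vel_apply, ← map_sub toL2]
  rw [show toL2 (y.fst 0 - y.fst 1) = z.snd 0 - z.snd 1 by rw [map_sub, e1, e2], ← e1]
  linarith

/-- The multiplier `u`. -/
theorem multiplier_u (h : (z, y) ∈ genGraph matA matD) :
    quadDer (disp 0) (vel 0) z y
      = ‖z.snd 0‖ ^ 2 - ‖der (z.fst 0)‖ ^ 2 - ‖toL2 (z.fst 0)‖ ^ 2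
        - (damp y * (starRingEnd ℂ) (trace (z.fst 0))).re := by
  obtain ⟨e1, e2⟩ := (mem_genGraph_iff.1 h).1
  have h1 := congrArg Complex.re (weak_u h (z.fst 0))
  have s1 : (⟪toL2 (z.fst 0), toL2 (z.fst 0)⟫_ℂ).re
      = ‖toL2 (z.fst 0)‖ ^ 2 := inner_self_eq_norm_sq (𝕜 := ℂ) _
  have s2 : (⟪der (z.fst 0), der (z.fst 0)⟫_ℂ).re
      = ‖der (z.fst 0)‖ ^ 2 := inner_self_eq_norm_sq (𝕜 := ℂ) _
  have s3 : (⟪z.snd 0, z.snd 0⟫_ℂ).re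
      = ‖z.snd 0‖ ^ 2 := inner_self_eq_norm_sq (𝕜 := ℂ) _
  rw [inner_add_right] at h1
  simp only [Complex.add_re, Complex.zero_re, s1, s2] at h1
  simp only [quadDer, disp_apply, vel_apply, ← e1, s3]
  linarith

/-- The multiplier `x u_x`. -/
theorem multiplier_x_u (h : (z, y) ∈ genGraph matA matD) :
    2 * quadDer (mulX ∘L dispDer 0) (vel 0) z y
      = ‖damp y‖ ^ 2 - ‖der (z.fst 0)‖ ^ 2 + (‖trace (y.fst 0)‖ ^ 2 - ‖z.snd 0‖ ^ 2)
        - 2 * (⟪mulX (der (z.fst 0)), toL2 (z.fst 0)⟫_ℂ).re := by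
  obtain ⟨e1, e2⟩ := (mem_genGraph_iff.1 h).1
  have h1 := multiplier_identity (p := y.fst 0) (weak_u h)
  rw [inner_add_right, Complex.add_re, ← e1] at h1
  simp only [quadDer, ContinuousLinearMap.comp_apply, dispDer_apply, vel_apply]
  linarith

end identities

/-! ### The Lyapunov functional and its derivative -/

/-- The functional pairing the equations of `u` and `w`. -/
def cross (z : State 2) : ℝ := quad (disp 0) (vel 0 - vel 1) z - quad (vel 0) (disp 0 - disp 1) z

/-- The derivative of `cross` at `z` in the direction `y`. -/
def crossDer (z y : State 2) : ℝ :=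
  quadDer (disp 0) (vel 0 - vel 1) z y - quadDer (vel 0) (disp 0 - disp 1) z y

/-- The combination of multipliers that controls the energy up to the `defect` of the
time-differentiated state. Up to terms in the damped quantity `d`, and in this order, the first
three summands control `w_x`, `w'` and `u`, the next two control `u_x` at the expense of `-3 ‖u'‖²`,
and the energy absorbs `|d|²`. -/
def lyap (z : State 2) : ℝ :=
  (93 / 5) * (2 * quad (mulX ∘L (dispDer 0 - dispDer 1)) (vel 0 - vel 1) z)
    + (68 / 5) * quad (disp 0 - disp 1) (vel 0 - vel 1) z + (68 / 5) * cross z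
    + (14 / 5) * quad (disp 0) (vel 0) z - (1 / 5) * (2 * quad (mulX ∘L dispDer 0) (vel 0) z)
    + 1550 * energy z

/-- The derivative of `lyap` at `z` in the direction `y`. -/
def lyapDer (z y : State 2) : ℝ :=
  (93 / 5) * (2 * quadDer (mulX ∘L (dispDer 0 - dispDer 1)) (vel 0 - vel 1) z y)
    + (68 / 5) * quadDer (disp 0 - disp 1) (vel 0 - vel 1) z y + (68 / 5) * crossDer z y
    + (14 / 5) * quadDer (disp 0) (vel 0) z y
    - (1 / 5) * (2 * quadDer (mulX ∘L dispDer 0) (vel 0) z y)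
    + 1550 * energyDer z y

/-- The quadratic form `‖u‖²/2 - ‖w‖²/2 - |u(1)|²/40 - |w(1)|²/2` in the displacements. -/
def defect (z : State 2) : ℝ :=
  ‖disp 0 z‖ ^ 2 / 2 - ‖disp 0 z - disp 1 z‖ ^ 2 / 2 - ‖bdry 0 z‖ ^ 2 / 40
    - ‖bdry 0 z - bdry 1 z‖ ^ 2 / 2

theorem abs_re_mul_conj_le (a b : ℂ) : |(a * (starRingEnd ℂ) b).re| ≤ ‖a‖ * ‖b‖ := by
  refine (Complex.abs_re_le_norm _).trans_eq ?_
  rw [norm_mul, RCLike.norm_conj]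

/-- The `defect` of a solution is bounded by a time derivative, as the boundary terms of the
multiplier `cross` are absorbed by the dissipation. -/
theorem defect_le {z y : State 2} (h : (z, y) ∈ genGraph matA matD) :
    defect z ≤ -(crossDer z y + 21 * energyDer z y) := by
  have h1 := multiplier_cross h
  have h2 := energyDer_eq h
  have b1 := abs_le.1 (abs_re_mul_conj_le (damp y) (trace (z.fst 0)))
  have b2 := abs_le.1 (abs_re_mul_conj_le (damp y) (trace (z.fst 0 - z.fst 1)))
  have b3 : (⟪toL2 (z.fst 0 - z.fst 1), toL2 (z.fst 0)⟫_ℂ).re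
      ≤ ‖toL2 (z.fst 0 - z.fst 1)‖ * ‖toL2 (z.fst 0)‖ :=
    (Complex.re_le_norm _).trans (norm_inner_le_norm _ _)
  rw [defect, crossDer, h1, h2]
  simp only [disp_apply, bdry_apply, ← map_sub]
  nlinarith [sq_nonneg (‖toL2 (z.fst 0 - z.fst 1)‖ - ‖toL2 (z.fst 0)‖),
    sq_nonneg (‖damp y‖ - ‖trace (z.fst 0 - z.fst 1)‖),
    sq_nonneg (40 * ‖damp y‖ - ‖trace (z.fst 0)‖), sq_nonneg ‖damp y‖]

/-- The final quadratic inequality, for `a = ‖w_x‖`, `b = ‖u‖`, `l = ‖u_x‖` and `δ = |d|`. -/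
theorem quadratic_estimate (a b l δ : ℝ) :
    a ^ 2 / 3 + b ^ 2 / 6 + l ^ 2 / 2 + 186 / 5 * (a * b) + 2 / 5 * (l * b) + 68 / 5 * (δ * a)
      + 30 * (δ * l)
      ≤ 161 / 5 * a ^ 2 + 82 / 5 * b ^ 2 + 13 / 5 * l ^ 2 + 3000 * δ ^ 2 := by
  have h1 : a * b ≤ 2 / 3 * a ^ 2 + 3 / 8 * b ^ 2 := by linarith [sq_nonneg (4 * a - 3 * b)]
  have h2 : 2 * (l * b) ≤ l ^ 2 + b ^ 2 := by linarith [sq_nonneg (l - b)]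
  have h3 : δ * a ≤ a ^ 2 / 100 + 25 * δ ^ 2 := by linarith [sq_nonneg (a / 10 - 5 * δ)]
  have h4 : δ * l ≤ l ^ 2 / 100 + 25 * δ ^ 2 := by linarith [sq_nonneg (l / 10 - 5 * δ)]
  linarith [sq_nonneg a, sq_nonneg b, sq_nonneg l, sq_nonneg δ]

/-- The energy is controlled by the derivative of `lyap` and the `defect` of the
time-differentiated state. In equal proportions, the multipliers `x w_x`, `w` and `cross` combine to
the quadratic form `2‖w_x‖² + ‖u‖² + 2 Re ∫ x w̄_x u`, which is positive definite because
`0 ≤ x ≤ 1`; a surplus of `x w_x`, small enough to keep the form definite, adds `‖w'‖²`. -/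
theorem energy_le_lyapDer {z y : State 2} (h : (z, y) ∈ genGraph matA matD) :
    energy z / 6 ≤ -lyapDer z y + 8 * defect y := by
  have i1 := multiplier_x_w h
  have i2 := multiplier_w h
  have i3 := multiplier_cross h
  have i4 := multiplier_u h
  have i5 := multiplier_x_u h
  have i6 := energyDer_eq h
  obtain ⟨e1, e2⟩ := (mem_genGraph_iff.1 h).1
  have b1 := abs_le.1 (abs_re_mul_conj_le (damp y) (trace (z.fst 0)))
  have b2 := abs_le.1 (abs_re_mul_conj_le (damp y) (trace (z.fst 0 - z.fst 1)))
  have t1 := norm_trace_le (z.fst 0)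
  have t2 := norm_trace_le (z.fst 0 - z.fst 1)
  have b3 : |(⟪mulX (der (z.fst 0 - z.fst 1)), toL2 (z.fst 0)⟫_ℂ).re|
      ≤ ‖der (z.fst 0 - z.fst 1)‖ * ‖toL2 (z.fst 0)‖ :=
    (Complex.abs_re_le_norm _).trans ((norm_inner_le_norm _ _).trans
      (mul_le_mul_of_nonneg_right (norm_mulX_le _) (norm_nonneg _)))
  have b4 : |(⟪mulX (der (z.fst 0)), toL2 (z.fst 0)⟫_ℂ).re|
      ≤ ‖der (z.fst 0)‖ * ‖toL2 (z.fst 0)‖ :=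
    (Complex.abs_re_le_norm _).trans ((norm_inner_le_norm _ _).trans
      (mul_le_mul_of_nonneg_right (norm_mulX_le _) (norm_nonneg _)))
  have b3' := abs_le.1 b3
  have b4' := abs_le.1 b4
  have hv : ‖der (z.fst 1)‖ ^ 2 ≤ 2 * ‖der (z.fst 0)‖ ^ 2 + 2 * ‖der (z.fst 0 - z.fst 1)‖ ^ 2 := by
    have : ‖der (z.fst 1)‖ ≤ ‖der (z.fst 0)‖ + ‖der (z.fst 0 - z.fst 1)‖ := by
      have := norm_sub_le (der (z.fst 0)) (der (z.fst 0 - z.fst 1))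
      rwa [← map_sub, sub_sub_cancel] at this
    nlinarith [sq_nonneg (‖der (z.fst 0)‖ - ‖der (z.fst 0 - z.fst 1)‖),
      norm_nonneg (der (z.fst 1))]
  have hv' : ‖z.snd 1‖ ^ 2 ≤ 2 * ‖z.snd 0‖ ^ 2 + 2 * ‖z.snd 0 - z.snd 1‖ ^ 2 := by
    have : ‖z.snd 1‖ ≤ ‖z.snd 0‖ + ‖z.snd 0 - z.snd 1‖ := by
      have := norm_sub_le (z.snd 0) (z.snd 0 - z.snd 1)
      rwa [sub_sub_cancel] at this
    nlinarith [sq_nonneg (‖z.snd 0‖ - ‖z.snd 0 - z.snd 1‖), norm_nonneg (z.snd 1)]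
  have hdef : defect y = ‖z.snd 0‖ ^ 2 / 2 - ‖z.snd 0 - z.snd 1‖ ^ 2 / 2
      - ‖trace (y.fst 0)‖ ^ 2 / 40 - ‖damp y‖ ^ 2 / 2 := by
    rw [defect, e1, e2]; rfl
  -- the term `8 * defect y` turns `-3‖u'‖² + 5‖w'‖²` into `‖u'‖² + ‖w'‖²` and cancels the boundary
  -- term `|u'(1)|²/5` of the multiplier `x u_x`
  rw [hdef, energy_eq, lyapDer, i1, i2, crossDer, i3, i4, i5, i6]
  have n0 := norm_nonneg (damp y)
  have c1 := mul_le_mul_of_nonneg_left t1 n0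
  have c2 := mul_le_mul_of_nonneg_left t2 n0
  have := quadratic_estimate ‖der (z.fst 0 - z.fst 1)‖ ‖toL2 (z.fst 0)‖ ‖der (z.fst 0)‖ ‖damp y‖
  linarith [sq_nonneg ‖z.snd 0‖, sq_nonneg ‖z.snd 0 - z.snd 1‖, sq_nonneg ‖damp y‖]

theorem hasDerivWithinAt_energy {Z : ℝ → State 2} {y : State 2} {s : Set ℝ} {t : ℝ}
    (h : HasDerivWithinAt Z y s t) :
    HasDerivWithinAt (fun t => energy (Z t)) (energyDer (Z t) y) s t :=
  ((((hasDerivWithinAt_quad _ _ h).add (hasDerivWithinAt_quad _ _ h)).add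
    (hasDerivWithinAt_quad _ _ h)).add (hasDerivWithinAt_quad _ _ h)).add
    (hasDerivWithinAt_quad _ _ h)

theorem hasDerivWithinAt_cross {Z : ℝ → State 2} {y : State 2} {s : Set ℝ} {t : ℝ}
    (h : HasDerivWithinAt Z y s t) :
    HasDerivWithinAt (fun t => cross (Z t)) (crossDer (Z t) y) s t :=
  (hasDerivWithinAt_quad _ _ h).sub (hasDerivWithinAt_quad _ _ h)

theorem hasDerivWithinAt_lyap {Z : ℝ → State 2} {y : State 2} {s : Set ℝ} {t : ℝ}
    (h : HasDerivWithinAt Z y s t) :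
    HasDerivWithinAt (fun t => lyap (Z t)) (lyapDer (Z t) y) s t :=
  (((((((hasDerivWithinAt_quad _ _ h).const_mul 2).const_mul (93 / 5)).add
    ((hasDerivWithinAt_quad _ _ h).const_mul (68 / 5))).add
    ((hasDerivWithinAt_cross h).const_mul (68 / 5))).add
    ((hasDerivWithinAt_quad _ _ h).const_mul (14 / 5))).sub
    (((hasDerivWithinAt_quad _ _ h).const_mul 2).const_mul (1 / 5))).add
    ((hasDerivWithinAt_energy h).const_mul 1550)

/-- A functional bounded by a multiple of the squared norm. -/
def IsQuadBounded (f : State 2 → ℝ) : Prop := ∃ C : ℝ, 0 ≤ C ∧ ∀ z, |f z| ≤ C * ‖z‖ ^ 2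

theorem isQuadBounded_quad {F : Type*} [NormedAddCommGroup F] [InnerProductSpace ℂ F]
    (S T : State 2 →L[ℂ] F) : IsQuadBounded (quad S T) :=
  ⟨‖S‖ * ‖T‖, by positivity, abs_quad_le S T⟩

theorem IsQuadBounded.add {f g : State 2 → ℝ} (hf : IsQuadBounded f) (hg : IsQuadBounded g) :
    IsQuadBounded fun z => f z + g z := by
  obtain ⟨C, hC, h1⟩ := hf
  obtain ⟨C', hC', h2⟩ := hg
  refine ⟨C + C', add_nonneg hC hC', fun z => (abs_add_le _ _).trans ?_⟩
  rw [add_mul]; exact add_le_add (h1 z) (h2 z)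

theorem IsQuadBounded.const_mul {f : State 2 → ℝ} (hf : IsQuadBounded f) (c : ℝ) :
    IsQuadBounded fun z => c * f z := by
  obtain ⟨C, hC, h1⟩ := hf
  refine ⟨|c| * C, by positivity, fun z => ?_⟩
  rw [abs_mul, mul_assoc]; exact mul_le_mul_of_nonneg_left (h1 z) (abs_nonneg _)

theorem IsQuadBounded.sub {f g : State 2 → ℝ} (hf : IsQuadBounded f) (hg : IsQuadBounded g) :
    IsQuadBounded fun z => f z - g z := by
  have := hf.add (hg.const_mul (-1))
  simpa [sub_eq_add_neg] using this

theorem isQuadBounded_energy : IsQuadBounded energy :=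
  ((((isQuadBounded_quad _ _).add (isQuadBounded_quad _ _)).add (isQuadBounded_quad _ _)).add
    (isQuadBounded_quad _ _)).add (isQuadBounded_quad _ _)

theorem isQuadBounded_cross : IsQuadBounded cross :=
  (isQuadBounded_quad _ _).sub (isQuadBounded_quad _ _)

theorem isQuadBounded_lyap : IsQuadBounded lyap :=
  (((((((isQuadBounded_quad _ _).const_mul 2).const_mul (93 / 5)).add
    ((isQuadBounded_quad _ _).const_mul (68 / 5))).add
    (isQuadBounded_cross.const_mul (68 / 5))).add
    ((isQuadBounded_quad _ _).const_mul (14 / 5))).sub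
    (((isQuadBounded_quad _ _).const_mul 2).const_mul (1 / 5))).add
    (isQuadBounded_energy.const_mul 1550)

theorem defect_eq (z : State 2) : defect z = quad (disp 0) (disp 0) z * (1 / 2)
    - quad (disp 0 - disp 1) (disp 0 - disp 1) z * (1 / 2) - quad (bdry 0) (bdry 0) z * (1 / 40)
    - quad (bdry 0 - bdry 1) (bdry 0 - bdry 1) z * (1 / 2) := by
  simp only [quad_self, defect, sub_apply]; ring

theorem continuous_defect : Continuous defect := by
  rw [funext defect_eq]
  exact ((((continuous_quad _ _).mul continuous_const).sub
    ((continuous_quad _ _).mul continuous_const)).sub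
    ((continuous_quad _ _).mul continuous_const)).sub ((continuous_quad _ _).mul continuous_const)

theorem isQuadBounded_defect : IsQuadBounded defect := by
  rw [funext defect_eq]
  simp only [mul_comm _ (1 / 2 : ℝ), mul_comm _ (1 / 40 : ℝ)]
  exact ((((isQuadBounded_quad _ _).const_mul _).sub ((isQuadBounded_quad _ _).const_mul _)).sub
    ((isQuadBounded_quad _ _).const_mul _)).sub ((isQuadBounded_quad _ _).const_mul _)

/-! ### Decay of classical solutions -/

theorem integrableOn_Icc_comp {E : Type*} [TopologicalSpace E] {X : ℝ → E}
    (h : ContinuousOn X (Ici 0)) {Q : E → ℝ} (hQ : Continuous Q) {T : ℝ} :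
    IntegrableOn (fun t => Q (X t)) (Icc 0 T) :=
  ((hQ.comp_continuousOn h).mono Icc_subset_Ici_self).integrableOn_Icc

/-- `Z` is a solution on `[0,∞)`, with time derivative `Y`, of the evolution equation whose
operator has the graph `G`. -/
structure IsSol {E : Type*} [NormedAddCommGroup E] [NormedSpace ℂ E] (G : Submodule ℂ (E × E))
    (Z Y : ℝ → E) : Prop where
  mem : ∀ t, 0 ≤ t → (Z t, Y t) ∈ G
  deriv : ∀ t, 0 ≤ t → HasDerivWithinAt Z (Y t) (Ici 0) t

namespace IsSol

section generic

variable {E : Type*} [NormedAddCommGroup E] [NormedSpace ℂ E] {G : Submodule ℂ (E × E)}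
  {Z Y : ℝ → E}

theorem continuousOn (h : IsSol G Z Y) : ContinuousOn Z (Ici 0) :=
  fun t ht => (h.deriv t ht).continuousWithinAt

theorem shift (h : IsSol G Z Y) {s : ℝ} (hs : 0 ≤ s) :
    IsSol G (fun t => Z (t + s)) (fun t => Y (t + s)) where
  mem t ht := h.mem _ (add_nonneg ht hs)
  deriv t ht := by
    have h1 : HasDerivWithinAt (fun t : ℝ => t + s) 1 (Ici 0) t :=
      ((hasDerivAt_id t).add_const s).hasDerivWithinAt
    have := HasDerivWithinAt.scomp t (h.deriv (t + s) (add_nonneg ht hs)) h1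
      (fun r hr => add_nonneg (mem_Ici.1 hr) hs)
    rwa [one_smul] at this

theorem sub {Z' Y' : ℝ → E} (h : IsSol G Z Y) (h' : IsSol G Z' Y') :
    IsSol G (fun t => Z t - Z' t) (fun t => Y t - Y' t) where
  mem t ht := G.sub_mem (h.mem t ht) (h'.mem t ht)
  deriv t ht := (h.deriv t ht).sub (h'.deriv t ht)

theorem smul (h : IsSol G Z Y) (c : ℝ) : IsSol G (fun t => c • Z t) (fun t => c • Y t) where
  mem t ht := G.smul_mem (c : ℂ) (h.mem t ht)
  deriv t ht := (h.deriv t ht).const_smul c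

/-- The difference quotient `s⁻¹ (Z (t + s) - Z t)`. -/
def quotient (Z : ℝ → E) (s t : ℝ) : E := s⁻¹ • (Z (t + s) - Z t)

theorem isSol_quotient (h : IsSol G Z Y) {s : ℝ} (hs : 0 ≤ s) :
    IsSol G (quotient Z s) (quotient Y s) :=
  ((h.shift hs).sub h).smul s⁻¹

theorem tendsto_quotient (h : IsSol G Z Y) {t : ℝ} (ht : 0 ≤ t) :
    Tendsto (fun s => quotient Z s t) (𝓝[>] 0) (𝓝 (Y t)) := by
  have h1 : HasDerivWithinAt Z (Y t) (Ioi t) t :=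
    (h.deriv t ht).mono fun r hr => mem_Ici.2 (ht.trans (le_of_lt hr))
  rw [hasDerivWithinAt_iff_tendsto_slope' (by simp)] at h1
  have h2 : Tendsto (fun s : ℝ => t + s) (𝓝[>] 0) (𝓝[>] t) := by
    refine tendsto_nhdsWithin_of_tendsto_nhds_of_eventually_within _ ?_ ?_
    · have : Tendsto (fun s : ℝ => t + s) (𝓝 0) (𝓝 (t + 0)) :=
        (continuous_const.add continuous_id).tendsto 0
      rw [add_zero] at this
      exact this.mono_left nhdsWithin_le_nhds
    · filter_upwards [self_mem_nhdsWithin] with s hs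
      exact mem_Ioi.2 (lt_add_of_pos_right t hs)
  refine (h1.comp h2).congr fun s => ?_
  simp [slope, quotient]

/-- The fundamental theorem of calculus for a functional along a solution, as an inequality. -/
theorem integral_le (h : IsSol G Z Y) {Q : E → ℝ} {Q' : E → E → ℝ}
    (hQ : ∀ {y : E} {s : Set ℝ} {t : ℝ}, HasDerivWithinAt Z y s t →
      HasDerivWithinAt (fun t => Q (Z t)) (Q' (Z t) y) s t)
    {φ : ℝ → ℝ} {a b : ℝ} (ha : 0 ≤ a) (hab : a ≤ b) (hφ : IntegrableOn φ (Icc a b))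
    (hle : ∀ t ∈ Ioo a b, φ t ≤ Q' (Z t) (Y t)) :
    ∫ t in a..b, φ t ≤ Q (Z b) - Q (Z a) := by
  refine intervalIntegral.integral_le_sub_of_hasDeriv_right_of_le hab
    (fun t ht => ((hQ (h.deriv t (ha.trans ht.1))).continuousWithinAt).mono
      fun r hr => mem_Ici.2 (ha.trans hr.1))
    (fun t ht => (hQ (h.deriv t (ha.trans ht.1.le))).mono fun r hr => ?_) hφ hle
  exact mem_Ici.2 ((ha.trans ht.1.le).trans (le_of_lt hr))

/-- A classical solution, with its continuous time derivative. -/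
theorem of_isClassicalSolution {T : E →ₗ.[ℂ] E} {z : T.domain} {Z : ℝ → E}
    (hZ : IsClassicalSolution T z Z) : ∃ Y : ℝ → E, IsSol T.graph Z Y ∧ ContinuousOn Y (Ici 0) ∧
      Z 0 = z ∧ Y 0 = T z := by
  obtain ⟨h0, hc, hs⟩ := hZ
  refine ⟨derivWithin Z (Ici 0), ⟨fun t ht => ?_, fun t ht => ?_⟩,
    hc.continuousOn_derivWithin (uniqueDiffOn_Ici 0) le_rfl, h0, ?_⟩
  · obtain ⟨hm, hd⟩ := hs t ht
    rw [hd.derivWithin (uniqueDiffOn_Ici 0 t ht)]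
    exact T.mem_graph ⟨Z t, hm⟩
  · obtain ⟨hm, hd⟩ := hs t ht
    exact hd.differentiableWithinAt.hasDerivWithinAt
  · obtain ⟨hm, hd⟩ := hs 0 le_rfl
    rw [hd.derivWithin (uniqueDiffOn_Ici 0 0 self_mem_Ici)]
    congr 1
    exact Subtype.ext h0

end generic

variable {Z Y : ℝ → State 2}

theorem energy_le (h : IsSol (genGraph matA matD) Z Y) {a b : ℝ} (ha : 0 ≤ a) (hab : a ≤ b) :
    energy (Z b) ≤ energy (Z a) := by
  have := h.integral_le (Q := fun z => -energy z) (Q' := fun z y => -energyDer z y)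
    (φ := fun _ => 0) (fun h => (hasDerivWithinAt_energy h).neg) ha hab
    (integrableOn_zero) (fun t ht => by
      rw [energyDer_eq (h.mem t (ha.trans ht.1.le))]; nlinarith [sq_nonneg ‖damp (Y t)‖])
  simp only [intervalIntegral.integral_zero] at this
  linarith

theorem norm_sq_le (h : IsSol (genGraph matA matD) Z Y) {t : ℝ} (ht : 0 ≤ t) :
    ‖Z t‖ ^ 2 ≤ 2 * ‖Z 0‖ ^ 2 := by
  have h1 := norm_sq_le_energy (Z t)
  have h2 := h.energy_le le_rfl ht
  have h3 := energy_le_norm_sq (Z 0)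
  linarith

end IsSol

theorem exists_integral_defect_le : ∃ C : ℝ, 0 ≤ C ∧
    ∀ (Z Y : ℝ → State 2), IsSol (genGraph matA matD) Z Y →
    ∀ T, 0 ≤ T → ∫ t in 0..T, defect (Z t) ≤ C * ‖Z 0‖ ^ 2 := by
  obtain ⟨C, hC, hb⟩ := isQuadBounded_cross.add (isQuadBounded_energy.const_mul 21)
  refine ⟨3 * C, by positivity, fun Z Y h T hT => ?_⟩
  have h1 := h.integral_le (Q := fun z => -(cross z + 21 * energy z))
    (Q' := fun z y => -(crossDer z y + 21 * energyDer z y)) (φ := fun t => defect (Z t))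
    (fun h => ((hasDerivWithinAt_cross h).add ((hasDerivWithinAt_energy h).const_mul 21)).neg)
    le_rfl hT (integrableOn_Icc_comp h.continuousOn continuous_defect)
    (fun t ht => defect_le (h.mem t ht.1.le))
  have h2 := abs_le.1 (hb (Z T))
  have h3 := abs_le.1 (hb (Z 0))
  have h4 := mul_le_mul_of_nonneg_left (h.norm_sq_le hT) hC
  linarith

/-- The estimate of `exists_integral_defect_le` for the time derivative of a solution, obtained by
passing to the limit in the difference quotients, which are solutions themselves. -/
theorem exists_integral_defect_deriv_le : ∃ C : ℝ, 0 ≤ C ∧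
    ∀ (Z Y : ℝ → State 2), IsSol (genGraph matA matD) Z Y →
    ∀ T, 0 ≤ T → ∫ t in 0..T, defect (Y t) ≤ C * ‖Y 0‖ ^ 2 := by
  obtain ⟨C, hC, hb⟩ := exists_integral_defect_le
  obtain ⟨K, hK, hd⟩ := isQuadBounded_defect
  refine ⟨C, hC, fun Z Y h T hT => ?_⟩
  have hr : Tendsto (fun s => C * ‖IsSol.quotient Z s 0‖ ^ 2) (𝓝[>] 0) (𝓝 (C * ‖Y 0‖ ^ 2)) :=
    (((h.tendsto_quotient le_rfl).norm).pow 2).const_mul C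
  have hl : Tendsto (fun s => ∫ t in 0..T, defect (IsSol.quotient Z s t)) (𝓝[>] 0)
      (𝓝 (∫ t in 0..T, defect (Y t))) := by
    refine intervalIntegral.tendsto_integral_filter_of_dominated_convergence
      (fun _ => K * (2 * (‖Y 0‖ + 1) ^ 2)) ?_ ?_ (by simp) ?_
    · filter_upwards [self_mem_nhdsWithin] with s hs
      rw [uIoc_of_le hT]
      exact ((integrableOn_Icc_comp (h.isSol_quotient (le_of_lt hs)).continuousOn
        continuous_defect).mono_set Ioc_subset_Icc_self).aestronglyMeasurable
    · filter_upwards [self_mem_nhdsWithin,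
        ((h.tendsto_quotient le_rfl).norm).eventually_lt_const (lt_add_one ‖Y 0‖)] with s hs hs1
      refine Eventually.of_forall fun t ht => ?_
      rw [uIoc_of_le hT] at ht
      rw [Real.norm_eq_abs]
      refine (hd _).trans (mul_le_mul_of_nonneg_left ?_ hK)
      refine ((h.isSol_quotient (le_of_lt hs)).norm_sq_le ht.1.le).trans ?_
      have := pow_le_pow_left₀ (norm_nonneg (IsSol.quotient Z s 0)) hs1.le 2
      linarith
    · refine Eventually.of_forall fun t ht => ?_
      rw [uIoc_of_le hT] at ht
      exact (continuous_defect.tendsto _).comp (h.tendsto_quotient ht.1.le)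
  refine le_of_tendsto_of_tendsto hl hr ?_
  filter_upwards [self_mem_nhdsWithin] with s hs
  exact hb _ _ (h.isSol_quotient (le_of_lt hs)) T hT

/-- The integral of the energy over `[0, T]` is bounded by the initial data, by `energy_le_lyapDer`;
as the energy is nonincreasing, it is at least `T * energy (Z T)`. -/
theorem exists_mul_energy_le : ∃ C : ℝ, 0 ≤ C ∧
    ∀ (Z Y : ℝ → State 2), IsSol (genGraph matA matD) Z Y →
    ContinuousOn Y (Ici 0) → ∀ T, 0 ≤ T → T * energy (Z T) ≤ C * (‖Z 0‖ ^ 2 + ‖Y 0‖ ^ 2) := by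
  obtain ⟨C, hC, hd⟩ := exists_integral_defect_deriv_le
  obtain ⟨K, hK, hb⟩ := isQuadBounded_lyap
  refine ⟨6 * (3 * K + 8 * C), by positivity, fun Z Y h hY T hT => ?_⟩
  have hi := integrableOn_Icc_comp hY continuous_defect (T := T)
  have hii : IntervalIntegrable (fun t => defect (Y t)) volume 0 T := by
    rw [intervalIntegrable_iff_integrableOn_Icc_of_le hT]; exact hi
  have h1 := h.integral_le (Q := fun z => -lyap z) (Q' := fun z y => -lyapDer z y)
    (φ := fun t => energy (Z T) / 6 - 8 * defect (Y t))
    (fun h => (hasDerivWithinAt_lyap h).neg) le_rfl hT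
    ((integrableOn_const (by simp)).sub (hi.const_mul 8))
    (fun t ht => by
      have e1 := energy_le_lyapDer (h.mem t ht.1.le)
      have e2 := h.energy_le ht.1.le ht.2.le
      linarith)
  rw [intervalIntegral.integral_sub (by simp) (hii.const_mul 8),
    intervalIntegral.integral_const, intervalIntegral.integral_const_mul, sub_zero,
    smul_eq_mul] at h1
  have h2 := hd Z Y h T hT
  have h3 := abs_le.1 (hb (Z T))
  have h4 := abs_le.1 (hb (Z 0))
  have h5 := mul_le_mul_of_nonneg_left (h.norm_sq_le hT) hK
  have h6 : 0 ≤ K * ‖Y 0‖ ^ 2 := by positivity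
  have h7 : 0 ≤ C * ‖Z 0‖ ^ 2 := by positivity
  linarith

/-- Every classical solution decays at the rate `t^{-1/2}`. -/
theorem exists_decay_rate : ∃ M : ℝ, 0 < M ∧
      ∀ (z : exGen.domain) (Z : ℝ → State 2), IsClassicalSolution exGen z Z →
        ∀ t : ℝ, 1 ≤ t → ‖Z t‖ ≤ M / t ^ (1 / 2 : ℝ) * graphNorm exGen z := by
  obtain ⟨C, hC, hb⟩ := exists_mul_energy_le
  refine ⟨Real.sqrt (2 * C) + 1, by positivity, fun z Z hZ t ht => ?_⟩
  obtain ⟨Y, hsol, hY, h0, hY0⟩ := IsSol.of_isClassicalSolution hZ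
  have ht0 : 0 < t := by linarith
  rw [exGen, gen_graph] at hsol
  have h1 := hb Z Y hsol hY t ht0.le
  rw [hY0, h0] at h1
  have h2 := norm_sq_le_energy (Z t)
  have hg : ‖(z : State 2)‖ ^ 2 + ‖exGen z‖ ^ 2 ≤ graphNorm exGen z ^ 2 := by
    rw [graphNorm]
    nlinarith [mul_nonneg (norm_nonneg (z : State 2)) (norm_nonneg (exGen z))]
  have hg0 : 0 ≤ graphNorm exGen z := by rw [graphNorm]; positivity
  have h3 : t * ‖Z t‖ ^ 2 ≤ 2 * C * graphNorm exGen z ^ 2 := by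
    have := mul_le_mul_of_nonneg_left hg hC
    nlinarith
  rw [← Real.sqrt_eq_rpow, div_mul_eq_mul_div, le_div_iff₀ (Real.sqrt_pos.2 ht0)]
  have h4 : ‖Z t‖ * Real.sqrt t ≤ Real.sqrt (2 * C) * graphNorm exGen z := by
    refine le_of_sq_le_sq ?_ (by positivity)
    rw [mul_pow, mul_pow, Real.sq_sqrt ht0.le, Real.sq_sqrt (by positivity)]
    linarith
  linarith

/-! ### The two matrices -/

theorem matA_posSemidef : matA.PosSemidef := by
  have : matA = matA.conjTranspose * matA := by
    ext i j; fin_cases i <;> fin_cases j <;> simp [matA, Matrix.mul_apply, Fin.sum_univ_two]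
  rw [this]
  exact Matrix.posSemidef_conjTranspose_mul_self _

theorem matD_posSemidef : matD.PosSemidef := by
  have : matD = (!![1, -1; 0, 0] : Matrix (Fin 2) (Fin 2) ℂ).conjTranspose * !![1, -1; 0, 0] := by
    ext i j; fin_cases i <;> fin_cases j <;> simp [matD, Matrix.mul_apply, Fin.sum_univ_two]
  rw [this]
  exact Matrix.posSemidef_conjTranspose_mul_self _

theorem matD_det : matD.det = 0 := by simp [matD, Matrix.det_fin_two]

theorem rank_fromCols : (Matrix.fromCols matD (matA * matD)).rank = 2 := by
  apply le_antisymm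
  · exact (Matrix.rank_le_card_height _).trans_eq (Fintype.card_fin 2)
  · -- `R` is a right inverse of the `2 × 4` matrix
    let R : Matrix (Fin 2 ⊕ Fin 2) (Fin 2) ℂ :=
      Matrix.fromRows !![0, -1; 0, 0] !![1, 1; 0, 0]
    have h : Matrix.fromCols matD (matA * matD) * R = 1 := by
      rw [Matrix.fromCols_mul_fromRows]
      ext i j; fin_cases i <;> fin_cases j <;>
        simp [matA, matD]
    have := Matrix.rank_mul_le_left (Matrix.fromCols matD (matA * matD)) R
    rwa [h, Matrix.rank_one, Fintype.card_fin] at this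

/-- The commutator of `A` and `D` is the unitary matrix `!![0, -1; 1, 0]`. -/
theorem norm_commutator : ‖Matrix.toEuclideanCLM (𝕜 := ℂ) (matA * matD - matD * matA)‖ = 1 := by
  have h : matA * matD - matD * matA ∈ unitary (Matrix (Fin 2) (Fin 2) ℂ) := by
    rw [Unitary.mem_iff, Matrix.star_eq_conjTranspose]
    constructor <;> ext i j <;> fin_cases i <;> fin_cases j <;>
      simp [matA, matD, Matrix.mul_apply, Fin.sum_univ_two]
  exact CStarRing.norm_of_mem_unitary
    (Unitary.map_mem (Matrix.toEuclideanCLM (n := Fin 2) (𝕜 := ℂ)) h)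

end BdryWave

end

theorem mainTheorem9 :
    -- the algebraic facts on the two matrices
    (BdryWave.matA.PosSemidef ∧ BdryWave.matD.PosSemidef ∧ BdryWave.matD.det = 0 ∧
      (Matrix.fromCols BdryWave.matD (BdryWave.matA * BdryWave.matD)).rank = 2 ∧
      ‖Matrix.toEuclideanCLM (𝕜 := ℂ) (BdryWave.matA * BdryWave.matD
        - BdryWave.matD * BdryWave.matA)‖ = 1) ∧
    -- the characteristic equation
    (∀ b b₁ : ℂ, b ≠ 0 → b₁ ≠ 0 → b₁ ^ 2 = b ^ 2 + 1 →
      (BdryWave.IsEigenvalue BdryWave.exGen b ↔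
        b₁ / b * Complex.cosh b₁ * (Complex.sinh b + Complex.cosh b)
          + Complex.cosh b * Complex.sinh b₁ = 0)) ∧
    -- the branch of eigenvalues approaching the imaginary axis
    (∃ β : ℕ → ℂ,
      (∀ n, BdryWave.IsEigenvalue BdryWave.exGen (β n)) ∧
      (fun n : ℕ => β n
        - (((n : ℂ) + 1 / 2) * (Real.pi : ℂ) * Complex.I
          + Complex.I / (4 * (((n : ℂ) + 1 / 2) * (Real.pi : ℂ)))
          - 1 / (32 * (((n : ℂ) + 1 / 2) * (Real.pi : ℂ)) ^ 2)))
        =O[atTop] (fun n : ℕ => ((n : ℝ) ^ 3)⁻¹) ∧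
      (fun n : ℕ => (β n).re) ~[atTop] (fun n : ℕ => -(1 / (32 * (n : ℝ) ^ 2 * Real.pi ^ 2)))) ∧
    -- the other branch of eigenvalues
    (∃ γ : ℕ → ℂ,
      (∀ n, BdryWave.IsEigenvalue BdryWave.exGen (γ n)) ∧
      Tendsto (fun n : ℕ => γ n - (n : ℂ) * (Real.pi : ℂ) * Complex.I) atTop
        (𝓝 (-((Real.log 3 / 2 : ℝ) : ℂ)))) ∧
    -- the decay rate `t ^ (-1/2)` holds
    (∃ M : ℝ, 0 < M ∧
      ∀ (z : BdryWave.exGen.domain) (Z : ℝ → BdryWave.State 2),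
        BdryWave.IsClassicalSolution BdryWave.exGen z Z →
        ∀ t : ℝ, 1 ≤ t →
          ‖Z t‖ ≤ M / t ^ (1 / 2 : ℝ)
            * BdryWave.graphNorm BdryWave.exGen z) ∧
    -- the decay rate `t ^ (-1/2)` cannot be improved
    (∃ c : ℝ, 0 < c ∧ ∀ t : ℝ, 1 ≤ t →
      ∃ (z : BdryWave.exGen.domain) (Z : ℝ → BdryWave.State 2),
        (z : BdryWave.State 2) ≠ 0 ∧
        BdryWave.IsClassicalSolution BdryWave.exGen z Z ∧
        c / t ^ (1 / 2 : ℝ) * BdryWave.graphNorm BdryWave.exGen z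
          ≤ ‖Z t‖) :=
  ⟨⟨BdryWave.matA_posSemidef, BdryWave.matD_posSemidef, BdryWave.matD_det,
    BdryWave.rank_fromCols, BdryWave.norm_commutator⟩,
    fun _ _ hb hb₁ h => BdryWave.isEigenvalue_exGen_iff hb hb₁ h,
    BdryWave.exists_eigenvalues_imaginary_branch, BdryWave.exists_eigenvalues_damped_branch,
    BdryWave.exists_decay_rate, BdryWave.exists_slow_solutions⟩
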